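/- **Conventions.** Formulas are built from countably many variables with $\land,\lor,\to,\gets,\top,\bot$; write $\neg\phi:=\phi\to\bot$ and ${\sim}\phi:=\top\gets\phi$. A *bi-Esakia space* is a compact topological space $X$ with a partial order $\le$ such that (i) for every clopen $U\subseteq X$ the generated downset $\downarrow U$ and upset $\uparrow U$ are clopen, and (ii) whenever $x\not\le y$ there is a clopen upset containing $x$ but not $y$. Its *dual* $X^*$ is the bi-Heyting algebra of clopen upsets, with $\cap,\cup,\emptyset,X$ and $$U\to V:=X\smallsetminus\downarrow(U\smallsetminus V),\qquad U\gets V:=\uparrow(U\smallsetminus V).$$ $X$ *refutes* $\varphi$ if $V(\varphi)\neq X$ for some valuation (homomorphism from the formula algebra) $V$ into $X^*$; otherwise $X$ *validates* $\varphi$. A finite poset is regarded as a bi-Esakia space with the discrete topology. A *co-tree* is a poset with a greatest element all of whose principal upsets are chains; a *bi-Esakia co-tree* is a bi-Esakia space whose poset is a co-tree. For $n\ge 1$ the *$n$-comb* is the poset with points $x_1,\dots,x_n,x_1',\dots,x_n'$ in which $x_1<\dots<x_n$, $x_i'<x_j$ iff $i\le j$, and there are no other strict relations. For $n\ge 0$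 the *$n$-hcomb* is the poset with points $y_0,\dots,y_n,y_1',\dots,y_n'$ in which $y_0<y_1<\dots<y_n$, $y_i'<y_j$ iff $i\le j$, and there are no other strict relations. Let $\mathsf{bi\text{-}LC}$ be bi-intuitionistic propositional logic extended by $(p\to q)\lor(q\to p)$, and let $$LFC:=\mathsf{bi\text{-}LC}+\beta(\mathfrak F_0)+\mathcal J(\mathfrak F_1)+\mathcal J(\mathfrak F_2)+\mathcal J(\mathfrak F_3),$$ where $\mathfrak F_0$ is the co-tree $d\prec b\prec a\succ c\succ e$, $\mathfrak F_1$ is the chain $c\prec b\prec a$, $\mathfrak F_2$ is the chain $d\prec c\prec b\prec a$ with one further minimal point $a'\prec a$, and $\mathfrak F_3$ consists of a greatest element $a$ and three minimal points $b,c,d\prec a$. Here, for a finite co-tree $\mathfrak F$ with dual $A$, and distinct variables $p_a$ ($a\in A$), the *Jankov formula* is $$\mathcal J(\mathfrak F):=\neg{\sim}\bigwedge\Gamma\to\bigvee_{a\ne b}\neg{\sim}(p_a\leftrightarrow p_b),$$ where $\Gamma$ consists of $p_0\leftrightarrow\bot$, $p_1\leftrightarrow\top$ and all $p_{a\ast b}\leftrightarrow(p_a\ast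 p_b)$ with $a,b\in A$ and $\ast\in\{\land,\lor,\to,\gets\}$; the *subframe formula* $\beta(\mathfrak F)$ is defined in the same way, with $\Gamma$ consisting only of the formulas $p_{a\ast b}\leftrightarrow(p_a\ast p_b)$ with $\ast\in\{\lor,\gets\}$. **Theorem.** Let $n$ be a positive integer and let $X$ be an infinite bi-Esakia co-tree that validates every formula of $LFC$ and whose dual $X^*$ is generated, as a bi-Heyting algebra, by $n$ elements. If $X$ refutes a formula $\varphi$, then $X$ has a finite subposet $Y$ (with the induced order and the discrete topology) that also refutes $\varphi$ and is isomorphic either to an $m$-comb for some $m\ge 1$ or to an $m$-hcomb for some $m\ge 0$. -/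

import Mathlib

noncomputable section

namespace BiInt

universe u

/-! ### Formulas of bi-intuitionistic logic -/

/-- Formulas in the language `∧, ∨, →, ←, ⊤, ⊥` over the denumerable set of variables `ℕ`. -/
inductive Fm : Type
  | var : ℕ → Fm
  | top : Fm
  | bot : Fm
  | and : Fm → Fm → Fm
  | or : Fm → Fm → Fm
  | imp : Fm → Fm → Fm
  | coimp : Fm → Fm → Fm

namespace Fm

/-- `¬φ := φ → ⊥`. -/
def neg (φ : Fm) : Fm := imp φ bot

/-- `∼φ := ⊤ ← φ`. -/
def coneg (φ : Fm) : Fm := coimp top φ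

/-- `φ ↔ ψ`. -/
def iff (φ ψ : Fm) : Fm := and (imp φ ψ) (imp ψ φ)

/-- Finite conjunctions. -/
def bigAnd (l : List Fm) : Fm := l.foldr and top

/-- Finite disjunctions. -/
def bigOr (l : List Fm) : Fm := l.foldr or bot

/-- Uniform substitution. -/
def subst (s : ℕ → Fm) : Fm → Fm
  | var n => s n
  | top => top
  | bot => bot
  | and φ ψ => and (subst s φ) (subst s ψ)
  | or φ ψ => or (subst s φ) (subst s ψ)
  | imp φ ψ => imp (subst s φ) (subst s ψ)
  | coimp φ ψ => coimp (subst s φ) (subst s ψ)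

/-- The unique extension of an assignment of the variables to a bi-Heyting homomorphism from the
algebra of formulas; `a ← b` is the co-Heyting difference `a \ b`. -/
def eval {A : Type*} [BiheytingAlgebra A] (v : ℕ → A) : Fm → A
  | var n => v n
  | top => ⊤
  | bot => ⊥
  | and φ ψ => eval v φ ⊓ eval v ψ
  | or φ ψ => eval v φ ⊔ eval v ψ
  | imp φ ψ => eval v φ ⇨ eval v ψ
  | coimp φ ψ => eval v φ \ eval v ψ

end Fm

/-! ### Super-bi-intuitionistic logics -/

section Logic

open Fm

/-- A Hilbert axiomatization of the intuitionistic propositional calculus (the rules being modus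
ponens and uniform substitution). -/
def ipcAxioms : Set Fm :=
  let p := var 0
  let q := var 1
  let r := var 2
  { imp p (imp q p),
    imp (imp p (imp q r)) (imp (imp p q) (imp p r)),
    imp (and p q) p,
    imp (and p q) q,
    imp p (imp q (and p q)),
    imp p (or p q),
    imp q (or p q),
    imp (imp p r) (imp (imp q r) (imp (or p q) r)),
    imp bot p,
    top }

/-- The eight axioms for co-implication. -/
def coimpAxioms : Set Fm :=
  let p := var 0
  let q := var 1
  let r := var 2
  { imp p (or q (coimp p q)),
    imp (coimp p q) (coneg (imp p q)),
    imp (coimp (coimp p q) r) (coimp p (or q r)),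
    imp (neg (coimp p q)) (imp p q),
    imp (imp p (coimp q q)) (neg p),
    imp (neg p) (imp p (coimp q q)),
    imp (coimp (imp p p) q) (coneg q),
    imp (coneg q) (coimp (imp p p) q) }

/-- Super-bi-intuitionistic logics: sets of formulas that contain the axioms of the
bi-intuitionistic propositional calculus and are closed under its three rules. -/
structure IsLogic (L : Set Fm) : Prop where
  ipc : ipcAxioms ⊆ L
  coimp : coimpAxioms ⊆ L
  mp : ∀ φ ψ : Fm, φ ∈ L → imp φ ψ ∈ L → ψ ∈ L
  subst : ∀ (s : ℕ → Fm) (φ : Fm), φ ∈ L → Fm.subst s φ ∈ L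
  dn : ∀ φ : Fm, φ ∈ L → neg (coneg φ) ∈ L

/-- The bi-intuitionistic propositional calculus `bi-IPC`. -/
def biIPC : Set Fm := ⋂₀ {L | IsLogic L}

/-- `L + S`: the least super-bi-intuitionistic logic containing `L ∪ S`. -/
def extend (L S : Set Fm) : Set Fm := ⋂₀ {L' | IsLogic L' ∧ L ∪ S ⊆ L'}

/-- The bi-intuitionistic Gödel-Dummett logic `bi-LC := bi-IPC + (p → q) ∨ (q → p)`. -/
def biLC : Set Fm := extend biIPC {or (imp (var 0) (var 1)) (imp (var 1) (var 0))}

end Logic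

/-! ### Jankov and subframe formulas of finite bi-Heyting algebras -/

section Jankov

open Fm

/-- A list of the elements of a set in a finite type. -/
def finList {B : Type*} [Finite B] (S : Set B) : List B := S.toFinite.toFinset.toList

variable (A : Type*) [BiheytingAlgebra A] [Finite A]

/-- Pairwise distinct variables `p_a`, one for each element `a` of a finite algebra. -/
def pvar (a : A) : Fm := var (Finite.equivFin A a)

/-- The disjunction of all `¬∼(p_a ↔ p_b)` with `a ≠ b`. -/
def separation : Fm :=
  bigOr ((finList {ab : A × A | ab.1 ≠ ab.2}).map fun ab =>
    neg (coneg (iff (pvar A ab.1) (pvar A ab.2))))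

/-- The Jankov formula of `A`. In a subdirectly irreducible bi-Gödel algebra `B` one has
`¬∼b = 0` for all `b ≠ 1`, so that the assignments refuting it on `B` are given by the
bi-Heyting embeddings of `A` into `B`. -/
def jankov : Fm :=
  imp
    (neg (coneg (bigAnd
      (iff (pvar A ⊤) top :: iff (pvar A ⊥) bot ::
        (finList (Set.univ : Set (A × A))).flatMap fun ab =>
          [ iff (pvar A (ab.1 ⊓ ab.2)) (and (pvar A ab.1) (pvar A ab.2)),
            iff (pvar A (ab.1 ⊔ ab.2)) (or (pvar A ab.1) (pvar A ab.2)),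
            iff (pvar A (ab.1 ⇨ ab.2)) (imp (pvar A ab.1) (pvar A ab.2)),
            iff (pvar A (ab.1 \ ab.2)) (coimp (pvar A ab.1) (pvar A ab.2)) ]))))
    (separation A)

/-- The subframe formula of `A`: like the Jankov formula, but only the operations `∨` and `←` have
to be preserved. -/
def subframe : Fm :=
  imp
    (neg (coneg (bigAnd
      ((finList (Set.univ : Set (A × A))).flatMap fun ab =>
          [ iff (pvar A (ab.1 ⊔ ab.2)) (or (pvar A ab.1) (pvar A ab.2)),
            iff (pvar A (ab.1 \ ab.2)) (coimp (pvar A ab.1) (pvar A ab.2)) ]))))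
    (separation A)

end Jankov

/-- The elements `a 0, …, a (n - 1)` generate the bi-Heyting algebra `A`: the only subalgebra
containing all of them is `A` itself. -/
def Generates {A : Type*} [BiheytingAlgebra A] {n : ℕ} (a : Fin n → A) : Prop :=
  ∀ B : Set A, (∀ i, a i ∈ B) → ⊤ ∈ B → ⊥ ∈ B →
    (∀ x ∈ B, ∀ y ∈ B, x ⊓ y ∈ B ∧ x ⊔ y ∈ B ∧ x ⇨ y ∈ B ∧ x \ y ∈ B) → B = Set.univ

/-- `A` is `n`-generated. -/
def IsNGenerated (A : Type*) [BiheytingAlgebra A] (n : ℕ) : Prop :=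
  ∃ a : Fin n → A, Generates a

/-! ### Bi-Esakia spaces -/

/-- Bi-Esakia spaces: compact ordered spaces satisfying the Priestley separation axiom in which the
upset and the downset generated by a clopen set are clopen. -/
class BiEsakiaSpace (X : Type*) [PartialOrder X] [TopologicalSpace X] : Prop extends
    CompactSpace X, PriestleySpace X where
  isClopen_up : ∀ U : Set X, IsClopen U → IsClopen (upperClosure U : Set X)
  isClopen_down : ∀ U : Set X, IsClopen U → IsClopen (lowerClosure U : Set X)

section Dual

variable {X : Type*} [PartialOrder X] [TopologicalSpace X] [BiEsakiaSpace X]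

/-- `U → V := X ∖ ↓(U ∖ V)`. -/
def himpSet (U V : ClopenUpperSet X) : ClopenUpperSet X where
  carrier := (lowerClosure ((U : Set X) \ V) : Set X)ᶜ
  isClopen' := (BiEsakiaSpace.isClopen_down _ (U.isClopen.diff V.isClopen)).compl
  upper' := (lowerClosure ((U : Set X) \ V)).lower.compl

/-- `U ← V := ↑(U ∖ V)`. -/
def sdiffSet (U V : ClopenUpperSet X) : ClopenUpperSet X where
  carrier := (upperClosure ((U : Set X) \ V) : Set X)
  isClopen' := BiEsakiaSpace.isClopen_up _ (U.isClopen.diff V.isClopen)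
  upper' := (upperClosure ((U : Set X) \ V)).upper

theorem le_himpSet_iff (U V W : ClopenUpperSet X) : U ≤ himpSet V W ↔ U ⊓ V ≤ W := by
  constructor
  · rintro h x ⟨hU, hV⟩
    by_contra hW
    exact h hU (subset_lowerClosure ⟨hV, hW⟩)
  · intro h x hx hx'
    obtain ⟨y, ⟨hyV, hyW⟩, hxy⟩ := hx'
    exact hyW (h ⟨U.upper hxy hx, hyV⟩)

theorem sdiffSet_le_iff (U V W : ClopenUpperSet X) : sdiffSet U V ≤ W ↔ U ≤ V ⊔ W := by
  constructor
  · intro h x hU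
    by_cases hV : x ∈ (V : Set X)
    · exact Or.inl hV
    · exact Or.inr (h (subset_upperClosure ⟨hU, hV⟩))
  · intro h x hx
    obtain ⟨y, ⟨hyU, hyV⟩, hxy⟩ := hx
    rcases h hyU with h | h
    · exact absurd h hyV
    · exact W.upper hxy h

/-- The algebraic dual of a bi-Esakia space: the bi-Heyting algebra of clopen upsets, ordered by
inclusion. -/
instance instBiheytingClopenUpperSet : BiheytingAlgebra (ClopenUpperSet X) where
  himp := himpSet
  le_himp_iff := le_himpSet_iff
  compl U := himpSet U ⊥
  himp_bot _ := rfl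
  sdiff := sdiffSet
  sdiff_le_iff := sdiffSet_le_iff
  hnot U := sdiffSet ⊤ U
  top_sdiff _ := rfl

end Dual

/-- The bi-Esakia space `X` refutes `φ`: some valuation `V` on `X` has `V(φ) ≠ X`. -/
def Refutes (X : Type*) [PartialOrder X] [TopologicalSpace X] [BiEsakiaSpace X] (φ : Fm) : Prop :=
  ∃ v : ℕ → ClopenUpperSet X, φ.eval v ≠ ⊤

/-- The bi-Esakia space `X` validates every formula in `S`. -/
def Validates (X : Type*) [PartialOrder X] [TopologicalSpace X] [BiEsakiaSpace X]
    (S : Set Fm) : Prop :=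
  ∀ φ ∈ S, ∀ v : ℕ → ClopenUpperSet X, φ.eval v = ⊤

/-- Co-trees: posets with a greatest element whose principal upsets are chains. -/
structure IsCoTree (X : Type*) [PartialOrder X] : Prop where
  exists_coroot : ∃ r : X, ∀ x : X, x ≤ r
  isChain_up : ∀ x : X, IsChain (· ≤ ·) (Set.Ici x)

/-! ### Finite posets as bi-Esakia spaces -/

/-- The poset `P` with the discrete topology. -/
def WithDiscrete (P : Type u) : Type u := P

section WithDiscrete

variable (P : Type*) [PartialOrder P]

instance instPartialOrderWithDiscrete : PartialOrder (WithDiscrete P) :=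
  inferInstanceAs (PartialOrder P)

instance instTopologicalSpaceWithDiscrete : TopologicalSpace (WithDiscrete P) := ⊥

instance instDiscreteTopologyWithDiscrete : DiscreteTopology (WithDiscrete P) := ⟨rfl⟩

instance instFiniteWithDiscrete [Finite P] : Finite (WithDiscrete P) :=
  inferInstanceAs (Finite P)

instance instBiEsakiaSpaceWithDiscrete [Finite P] : BiEsakiaSpace (WithDiscrete P) where
  isCompact_univ := Set.finite_univ.isCompact
  priestley {x _} h := ⟨Set.Ici x, isClopen_discrete _, isUpperSet_Ici x, le_rfl, h⟩
  isClopen_up _ _ := isClopen_discrete _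
  isClopen_down _ _ := isClopen_discrete _

instance instFiniteClopenUpperSet {X : Type*} [PartialOrder X] [TopologicalSpace X] [Finite X] :
    Finite (ClopenUpperSet X) :=
  Finite.of_injective (fun U : ClopenUpperSet X => (U : Set X)) SetLike.coe_injective

/-- The Jankov formula of a finite poset `P`, i.e. that of its algebraic dual. -/
def jankovOf [Finite P] : Fm := jankov (ClopenUpperSet (WithDiscrete P))

/-- The subframe formula of a finite poset `P`, i.e. that of its algebraic dual. -/
def subframeOf [Finite P] : Fm := subframe (ClopenUpperSet (WithDiscrete P))

end WithDiscrete

/-! ### The finite co-trees used in the axiomatization -/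

/-- The co-tree with co-root `a`, immediate predecessors `b, c` of `a`, and `d ≺ b`, `e ≺ c`. -/
inductive F0 : Type
  | a | b | c | d | e
  deriving DecidableEq

namespace F0

instance : Fintype F0 := ⟨{a, b, c, d, e}, fun x => by cases x <;> decide⟩

/-- The order of `F0`. -/
def le : F0 → F0 → Bool
  | _, a => true
  | d, b => true
  | e, c => true
  | x, y => decide (x = y)

instance : PartialOrder F0 where
  le x y := le x y = true
  le_refl := by decide
  le_trans := by decide
  le_antisymm := by decide

end F0

/-- The three-element chain `c ≺ b ≺ a`. -/
inductive F1 : Type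
  | a | b | c
  deriving DecidableEq

namespace F1

instance : Fintype F1 := ⟨{a, b, c}, fun x => by cases x <;> decide⟩

/-- The order of `F1`. -/
def le : F1 → F1 → Bool
  | _, a => true
  | c, b => true
  | x, y => decide (x = y)

instance : PartialOrder F1 where
  le x y := le x y = true
  le_refl := by decide
  le_trans := by decide
  le_antisymm := by decide

end F1

/-- The chain `d ≺ c ≺ b ≺ a` together with a further immediate predecessor `a'` of `a`. -/
inductive F2 : Type
  | a | a' | b | c | d
  deriving DecidableEq

namespace F2

instance : Fintype F2 := ⟨{a, a', b, c, d}, fun x => by cases x <;> decide⟩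

/-- The order of `F2`. -/
def le : F2 → F2 → Bool
  | _, a => true
  | c, b => true
  | d, b => true
  | d, c => true
  | x, y => decide (x = y)

instance : PartialOrder F2 where
  le x y := le x y = true
  le_refl := by decide
  le_trans := by decide
  le_antisymm := by decide

end F2

/-- The co-tree with co-root `a` and exactly three further points `b, c, d`, all minimal. -/
inductive F3 : Type
  | a | b | c | d
  deriving DecidableEq

namespace F3

instance : Fintype F3 := ⟨{a, b, c, d}, fun x => by cases x <;> decide⟩

/-- The order of `F3`. -/
def le : F3 → F3 → Bool
  | _, a => true
  | x, y => decide (x = y)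

instance : PartialOrder F3 where
  le x y := le x y = true
  le_refl := by decide
  le_trans := by decide
  le_antisymm := by decide

end F3

/-- The logic `LFC := bi-LC + β(F0) + J(F1) + J(F2) + J(F3)`. -/
def LFC : Set Fm := extend biLC {subframeOf F0, jankovOf F1, jankovOf F2, jankovOf F3}

/-! ### Finite combs, with and without handle -/

/-- The `n`-comb: `spine i` and `tooth i` are the points `x_{i+1}` and `x'_{i+1}`. -/
inductive Comb (n : ℕ) : Type
  | spine : Fin n → Comb n
  | tooth : Fin n → Comb n

namespace Comb

variable {n : ℕ}

/-- `x_i ≤ x_j` and `x'_i ≤ x_j` iff `i ≤ j`, and the points `x'_i` are minimal. -/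
def le : Comb n → Comb n → Prop
  | spine i, spine j => i ≤ j
  | tooth i, spine j => i ≤ j
  | tooth i, tooth j => i = j
  | spine _, tooth _ => False

instance : PartialOrder (Comb n) where
  le := le
  le_refl x := by cases x <;> simp [le]
  le_trans x y z := by cases x <;> cases y <;> cases z <;> simp only [le] <;> grind
  le_antisymm x y := by cases x <;> cases y <;> simp only [le] <;> grind

end Comb

/-- The `n`-hcomb: `spine i` is the point `y_i` and `tooth i` is the point `y'_{i+1}`. -/
inductive HComb (n : ℕ) : Type
  | spine : Fin (n + 1) → HComb n
  | tooth : Fin n → HComb n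

namespace HComb

variable {n : ℕ}

/-- `y_i ≤ y_j` and `y'_i ≤ y_j` iff `i ≤ j`, and the points `y'_i` are minimal. -/
def le : HComb n → HComb n → Prop
  | spine i, spine j => i ≤ j
  | tooth i, spine j => i.succ ≤ j
  | tooth i, tooth j => i = j
  | spine _, tooth _ => False

instance : PartialOrder (HComb n) where
  le := le
  le_refl x := by cases x <;> simp [le]
  le_trans x y z := by cases x <;> cases y <;> cases z <;> simp only [le] <;> grind
  le_antisymm x y := by cases x <;> cases y <;> simp only [le] <;> grind

end HComb

end BiInt

end

noncomputable section

namespace BiInt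

/-! ### Evaluation of formulas -/

section Evaluation

open Fm

variable {B : Type*} [BiheytingAlgebra B]

/-! The argument is a selective filtration. A finite `Y ⊆ X` containing the co-root refutes `φ` as
soon as, above and below each of its points, it has witnesses for finitely many clopen sets `W`: the
complement of the value of `φ`, and the sets `V(ψ) ∖ V(χ)` for the implications and co-implications
inside `φ` (`mem_eval_restrictValuation`, `refutes_of_isSelective`). The axioms of `LFC` allow `Y`
to be chosen as a comb, with or without handle.

Each axiom forbids a configuration, because a co-rooted space containing it refutes the matching
formula (`refutes_subframe`, `refutes_jankov`). The formula `β(F0)` makes the non-minimal points a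
chain (`le_total_of_not_isMin`). The formulas `J(F1)` and `J(F2)` put a minimal point below the
larger, but not below the smaller, of two distinct non-minimal points (`exists_isMin_le_not_le`);
this supplies teeth. The formula `J(F3)` bounds the number of minimal points that first appear below
an extremal point: one in general, two at the least non-minimal point of `X` (`isMin_unique_below`,
`isMin_below_least`).

By compactness, if `W` has non-minimal points, it has a greatest one. If `up W` has non-minimal
points, it has a least one, or else `W` contains the unique minimal lower bound of the whole chain.
These finitely many extremal points form the spine. Each gets one tooth, and uniqueness lets the
same tooth serve all `W` needing a witness there. Below the least spine point two minimal points may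
be needed: one becomes its tooth, the other the handle. -/

theorem eval_iff_eq_top (v : ℕ → B) (φ ψ : Fm) :
    (Fm.iff φ ψ).eval v = ⊤ ↔ φ.eval v = ψ.eval v := by
  rw [Fm.iff, Fm.eval, Fm.eval, Fm.eval, inf_eq_top_iff, himp_eq_top_iff, himp_eq_top_iff,
    le_antisymm_iff]

theorem eval_bigAnd_eq_top (v : ℕ → B) (l : List Fm) :
    (bigAnd l).eval v = ⊤ ↔ ∀ φ ∈ l, φ.eval v = ⊤ := by
  induction l with
  | nil => simp [bigAnd, Fm.eval]
  | cons φ l ih =>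
    rw [List.forall_mem_cons, ← ih]
    simp [bigAnd, Fm.eval]

theorem eval_bigOr_eq_bot (v : ℕ → B) (l : List Fm) :
    (bigOr l).eval v = ⊥ ↔ ∀ φ ∈ l, φ.eval v = ⊥ := by
  induction l with
  | nil => simp [bigOr, Fm.eval]
  | cons φ l ih =>
    rw [List.forall_mem_cons, ← ih]
    simp [bigOr, Fm.eval]

theorem mem_finList {A : Type*} [Finite A] {S : Set A} {a : A} : a ∈ finList S ↔ a ∈ S := by
  simp [finList]

/-- In `B`, the operation `¬∼` sends every element other than `⊤` to `⊥`. -/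
def NegConegTrivial (B : Type*) [BiheytingAlgebra B] : Prop :=
  ∀ b : B, b ≠ ⊤ → (⊤ \ b) ⇨ ⊥ = ⊥

variable {A : Type*} [Finite A]

/-- An assignment sending `p_a` to `h a`. -/
def pvarAssignment (h : A → B) (k : ℕ) : B :=
  -- The value `⊤` goes to variables that are not of the form `p_a`; the formulas evaluated below do
  -- not contain them.
  if hk : k < Nat.card A then h ((Finite.equivFin A).symm ⟨k, hk⟩) else ⊤

theorem eval_pvar (h : A → B) (a : A) : (pvar A a).eval (pvarAssignment h) = h a := by
  simp [pvar, Fm.eval, pvarAssignment]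

theorem eval_separation [Nontrivial B] (hB : NegConegTrivial B) {h : A → B}
    (hh : Function.Injective h) : (separation A).eval (pvarAssignment h) = ⊥ := by
  rw [separation, eval_bigOr_eq_bot]
  intro φ hφ
  obtain ⟨⟨a, b⟩, hab, rfl⟩ := List.mem_map.1 hφ
  rw [mem_finList] at hab
  refine hB _ fun htop => hab ?_
  rw [eval_iff_eq_top, eval_pvar, eval_pvar] at htop
  exact hh htop

/-- The antecedent becomes `¬∼⊤ = ⊤`, while injectivity of `h` turns every disjunct of the
consequent into `⊥`. This is shared by the Jankov and the subframe formulas. -/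
theorem eval_imp_separation_ne_top [Nontrivial B] (hB : NegConegTrivial B) {h : A → B}
    (hh : Function.Injective h) {Γ : Fm} (hΓ : Γ.eval (pvarAssignment h) = ⊤) :
    (imp (neg (coneg Γ)) (separation A)).eval (pvarAssignment h) ≠ ⊤ := by
  simp [Fm.eval, Fm.neg, Fm.coneg, hΓ, eval_separation hB hh]

variable [BiheytingAlgebra A]

theorem eval_jankov_ne_top [Nontrivial B] (hB : NegConegTrivial B) {h : A → B}
    (hh : Function.Injective h) (htop : h ⊤ = ⊤) (hbot : h ⊥ = ⊥)
    (hinf : ∀ a b, h (a ⊓ b) = h a ⊓ h b) (hsup : ∀ a b, h (a ⊔ b) = h a ⊔ h b)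
    (himp : ∀ a b, h (a ⇨ b) = h a ⇨ h b) (hsdiff : ∀ a b, h (a \ b) = h a \ h b) :
    (jankov A).eval (pvarAssignment h) ≠ ⊤ := by
  refine eval_imp_separation_ne_top hB hh ?_
  rw [eval_bigAnd_eq_top]
  simp only [List.mem_cons, List.mem_flatMap, List.not_mem_nil, or_false]
  rintro φ (rfl | rfl | ⟨⟨a, b⟩, -, rfl | rfl | rfl | rfl⟩) <;>
    simp [eval_iff_eq_top, eval_pvar, Fm.eval, *]

theorem eval_subframe_ne_top [Nontrivial B] (hB : NegConegTrivial B) {h : A → B}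
    (hh : Function.Injective h) (hsup : ∀ a b, h (a ⊔ b) = h a ⊔ h b)
    (hsdiff : ∀ a b, h (a \ b) = h a \ h b) :
    (subframe A).eval (pvarAssignment h) ≠ ⊤ := by
  refine eval_imp_separation_ne_top hB hh ?_
  rw [eval_bigAnd_eq_top]
  simp only [List.mem_cons, List.mem_flatMap, List.not_mem_nil, or_false]
  rintro φ ⟨⟨a, b⟩, -, rfl | rfl⟩ <;> simp [eval_iff_eq_top, eval_pvar, Fm.eval, *]

end Evaluation

/-! ### The operations on clopen upsets -/

section Operations

variable {X : Type*} [PartialOrder X]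

/-- The upset generated by a set. -/
def up (U : Set X) : Set X := {x | ∃ y ∈ U, y ≤ x}

/-- The downset generated by a set. -/
def down (U : Set X) : Set X := {x | ∃ y ∈ U, x ≤ y}

theorem isUpperSet_up (U : Set X) : IsUpperSet (up U) := (upperClosure U).upper

theorem isLowerSet_down (U : Set X) : IsLowerSet (down U) := (lowerClosure U).lower

variable [TopologicalSpace X]

theorem mem_sup {U V : ClopenUpperSet X} {x : X} : x ∈ U ⊔ V ↔ x ∈ U ∨ x ∈ V := Iff.rfl

theorem mem_top {x : X} : x ∈ (⊤ : ClopenUpperSet X) := trivial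

theorem not_mem_bot {x : X} : x ∉ (⊥ : ClopenUpperSet X) := fun h => h

theorem eq_top_of_forall_mem {U : ClopenUpperSet X} (h : ∀ x, x ∈ U) : U = ⊤ :=
  SetLike.ext fun x => ⟨fun _ => mem_top, fun _ => h x⟩

theorem nontrivial_clopenUpperSet (r : X) : Nontrivial (ClopenUpperSet X) :=
  ⟨⊤, ⊥, fun h => not_mem_bot (h ▸ mem_top : r ∈ (⊥ : ClopenUpperSet X))⟩

variable [BiEsakiaSpace X]

theorem mem_himp {U V : ClopenUpperSet X} {x : X} :
    x ∈ U ⇨ V ↔ ∀ y, x ≤ y → y ∈ U → y ∈ V := by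
  change x ∈ ((lowerClosure ((U : Set X) \ V) : Set X)ᶜ) ↔ _
  simp only [Set.mem_compl_iff, SetLike.mem_coe, mem_lowerClosure, Set.mem_sdiff]
  grind

theorem mem_sdiff {U V : ClopenUpperSet X} {x : X} :
    x ∈ U \ V ↔ ∃ y, y ≤ x ∧ y ∈ U ∧ y ∉ V := by
  change x ∈ (upperClosure ((U : Set X) \ V) : Set X) ↔ _
  simp only [SetLike.mem_coe, mem_upperClosure, Set.mem_sdiff]
  grind

theorem IsClopen.up {U : Set X} (h : IsClopen U) : IsClopen (up U) :=
  BiEsakiaSpace.isClopen_up U h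

theorem IsClopen.down {U : Set X} (h : IsClopen U) : IsClopen (down U) :=
  BiEsakiaSpace.isClopen_down U h

/-- If `b` misses a point, then `∼b`, an upset generated by the missed points, contains the co-root;
every point lies below the co-root, so none satisfies `∼b → ⊥`. -/
theorem negConegTrivial_of_top {r : X} (hr : ∀ x, x ≤ r) :
    NegConegTrivial (ClopenUpperSet X) := by
  intro b hb
  obtain ⟨y, hy⟩ : ∃ y, y ∉ b := by
    by_contra! h
    exact hb (eq_top_of_forall_mem h)
  refine SetLike.ext fun x => ⟨fun hx => ?_, fun hx => absurd hx not_mem_bot⟩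
  exact absurd (mem_himp.1 hx r (hr x) (mem_sdiff.2 ⟨y, hr y, mem_top, hy⟩)) not_mem_bot

variable {P : Type*} [PartialOrder P] [TopologicalSpace P] [BiEsakiaSpace P] [Finite P]

/-- A co-rooted bi-Esakia space that has the finite poset `P` as a bi-Esakia quotient refutes the
Jankov formula of `P`. -/
theorem refutes_jankov {r : X} (hr : ∀ x, x ≤ r) (f : X → P) (hf : ∀ p, IsClopen (f ⁻¹' {p}))
    (hmono : ∀ x y, x ≤ y → f x ≤ f y) (hup : ∀ x p, f x ≤ p → ∃ y, x ≤ y ∧ f y = p)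
    (hdown : ∀ x p, p ≤ f x → ∃ y, y ≤ x ∧ f y = p) (hsurj : Function.Surjective f) :
    Refutes X (jankov (ClopenUpperSet P)) := by
  have hpre (S : Set P) : IsClopen (f ⁻¹' S) := by
    rw [← Set.biUnion_preimage_singleton]
    exact S.toFinite.isClopen_biUnion fun p _ => hf p
  -- Duality: surjectivity of `f` makes the inverse image map injective, `hup` makes it preserve
  -- `→`, and `hdown` makes it preserve `←`.
  let h (U : ClopenUpperSet P) : ClopenUpperSet X :=
    ⟨⟨f ⁻¹' (U : Set P), hpre _⟩, fun x y hxy hx => U.upper (hmono x y hxy) hx⟩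
  have hmem (U) (x) : x ∈ h U ↔ f x ∈ U := Iff.rfl
  have := nontrivial_clopenUpperSet r
  refine ⟨pvarAssignment h, eval_jankov_ne_top (negConegTrivial_of_top hr) ?_ rfl rfl
    (fun _ _ => rfl) (fun _ _ => rfl) ?_ ?_⟩
  · intro U V hUV
    refine SetLike.ext fun p => ?_
    obtain ⟨x, rfl⟩ := hsurj p
    rw [← hmem, ← hmem, hUV]
  · intro U V
    refine SetLike.ext fun x => ?_
    rw [hmem, mem_himp, mem_himp]
    refine ⟨fun H y hxy hy => H _ (hmono x y hxy) hy, fun H p hp hpU => ?_⟩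
    obtain ⟨y, hxy, rfl⟩ := hup x p hp
    exact H y hxy hpU
  · intro U V
    refine SetLike.ext fun x => ?_
    rw [hmem, mem_sdiff, mem_sdiff]
    constructor
    · rintro ⟨p, hp, hpU, hpV⟩
      obtain ⟨y, hxy, rfl⟩ := hdown x p hp
      exact ⟨y, hxy, hpU, hpV⟩
    · rintro ⟨y, hy, hyU, hyV⟩
      exact ⟨f y, hmono y x hy, hyU, hyV⟩

/-- A family of clopen sets indexed by a finite poset `P` that behaves like an order embedding of
`P` gives a refutation of the subframe formula of `P`. -/
theorem refutes_subframe {r : X} (hr : ∀ x, x ≤ r) (W : P → Set X)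
    (hclopen : ∀ p, IsClopen (W p)) (hne : ∀ p, (W p).Nonempty)
    (hle : ∀ p q, p ≤ q → W q ⊆ up (W p)) (hnle : ∀ p q, ¬ q ≤ p → Disjoint (W p) (up (W q))) :
    Refutes X (subframe (ClopenUpperSet P)) := by
  let h (U : ClopenUpperSet P) : ClopenUpperSet X :=
    ⟨⟨⋃ p ∈ {p : P | p ∈ U}, up (W p),
      (Set.toFinite _).isClopen_biUnion fun p _ => IsClopen.up (hclopen p)⟩,
      isUpperSet_iUnion₂ fun p _ => isUpperSet_up _⟩
  have hmem (U) (x) : x ∈ h U ↔ ∃ p : P, p ∈ U ∧ x ∈ up (W p) :=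
    Set.mem_iUnion₂.trans (by simp)
  -- Points of `W p` detect whether `p ∈ U`. Injectivity and the preservation of `←` both rest on
  -- this.
  have hW (U : ClopenUpperSet P) (p : P) (x : X) (hx : x ∈ W p) :
      x ∈ h U ↔ p ∈ U := by
    rw [hmem]
    constructor
    · rintro ⟨q, hq, hxq⟩
      by_contra hp
      exact Set.disjoint_left.1 (hnle p q fun hqp => hp (U.upper hqp hq)) hx hxq
    · intro hp
      exact ⟨p, hp, x, hx, le_rfl⟩
  have := nontrivial_clopenUpperSet r
  refine ⟨pvarAssignment h, eval_subframe_ne_top (negConegTrivial_of_top hr) ?_ ?_ ?_⟩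
  · intro U V hUV
    refine SetLike.ext fun p => ?_
    obtain ⟨x, hx⟩ := hne p
    rw [← hW U p x hx, ← hW V p x hx, hUV]
  · intro U V
    refine SetLike.ext fun x => ?_
    rw [mem_sup, hmem, hmem, hmem]
    simp only [mem_sup]
    grind
  · intro U V
    refine SetLike.ext fun x => ?_
    rw [mem_sdiff, hmem]
    constructor
    · rintro ⟨p, hp, y, hy, hyx⟩
      obtain ⟨q, hqp, hqU, hqV⟩ := mem_sdiff.1 hp
      obtain ⟨z, hz, hzy⟩ := hle q p hqp hy
      exact ⟨z, hzy.trans hyx, (hW U q z hz).2 hqU, fun h => hqV ((hW V q z hz).1 h)⟩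
    · rintro ⟨y, hyx, hyU, hyV⟩
      obtain ⟨p, hpU, z, hz, hzy⟩ := (hmem _ _).1 hyU
      refine ⟨p, mem_sdiff.2 ⟨p, le_rfl, hpU, fun hpV => hyV ?_⟩, z, hz, hzy.trans hyx⟩
      exact (hmem _ _).2 ⟨p, hpV, z, hz, hzy⟩

theorem mem_LFC {φ : Fm}
    (h : φ ∈ ({subframeOf F0, jankovOf F1, jankovOf F2, jankovOf F3} : Set Fm)) : φ ∈ LFC :=
  Set.mem_sInter.2 fun _ hL => hL.2 (Or.inr h)

theorem not_refutes_of_mem {φ : Fm} (hX : Validates X LFC)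
    (h : φ ∈ ({subframeOf F0, jankovOf F1, jankovOf F2, jankovOf F3} : Set Fm)) :
    ¬ Refutes X φ := by
  rintro ⟨v, hv⟩
  exact hv (hX φ (mem_LFC h) v)

end Operations

/-! ### Compactness in Priestley spaces -/

section Priestley

variable {X : Type*} [PartialOrder X] [TopologicalSpace X] [PriestleySpace X]

theorem isClosed_Ici (a : X) : IsClosed (Set.Ici a) := by
  rw [← isOpen_compl_iff, isOpen_iff_forall_mem_open]
  intro x hx
  obtain ⟨U, hU, hup, ha, hxU⟩ := exists_isClopen_upper_of_not_le hx
  exact ⟨Uᶜ, fun y hy hay => hy (hup hay ha), hU.compl.isOpen, hxU⟩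

theorem isClosed_Iic (a : X) : IsClosed (Set.Iic a) := by
  rw [← isOpen_compl_iff, isOpen_iff_forall_mem_open]
  intro x hx
  obtain ⟨U, hU, hup, hxU, ha⟩ := exists_isClopen_upper_of_not_le hx
  exact ⟨U, fun y hy hya => ha (hup hya hy), hU.isOpen, hxU⟩

variable [CompactSpace X]

/-- A closed set that meets every principal downset of elements of a nonempty chain contains a
lower bound of the chain. -/
theorem exists_lowerBound_mem {K S : Set X} (hK : IsClosed K) (hS : S.Nonempty)
    (hchain : ∀ x ∈ S, ∀ y ∈ S, x ≤ y ∨ y ≤ x) (hSK : ∀ x ∈ S, ∃ y ∈ K, y ≤ x) :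
    ∃ y ∈ K, ∀ x ∈ S, y ≤ x := by
  have : Nonempty S := hS.to_subtype
  -- The sets `K ∩ ↓x` for `x ∈ S` are closed, nonempty and directed since `S` is a chain; a common
  -- point is the required bound.
  obtain ⟨y, hy⟩ := IsCompact.nonempty_iInter_of_directed_nonempty_isCompact_isClosed
    (fun x : S => K ∩ Set.Iic (x : X)) (fun x y => by
      rcases hchain x x.2 y y.2 with h | h
      · exact ⟨x, subset_rfl, fun z hz => ⟨hz.1, hz.2.trans h⟩⟩
      · exact ⟨y, fun z hz => ⟨hz.1, hz.2.trans h⟩, subset_rfl⟩)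
    (fun x => (hSK x x.2).imp fun y hy => hy)
    (fun x => (hK.inter (isClosed_Iic _)).isCompact) (fun x => hK.inter (isClosed_Iic _))
  rw [Set.mem_iInter] at hy
  exact ⟨y, (hy (Classical.arbitrary S)).1, fun x hx => (hy ⟨x, hx⟩).2⟩

theorem exists_upperBound_mem {K S : Set X} (hK : IsClosed K) (hS : S.Nonempty)
    (hchain : ∀ x ∈ S, ∀ y ∈ S, x ≤ y ∨ y ≤ x) (hSK : ∀ x ∈ S, ∃ y ∈ K, x ≤ y) :
    ∃ y ∈ K, ∀ x ∈ S, x ≤ y := by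
  have : Nonempty S := hS.to_subtype
  obtain ⟨y, hy⟩ := IsCompact.nonempty_iInter_of_directed_nonempty_isCompact_isClosed
    (fun x : S => K ∩ Set.Ici (x : X)) (fun x y => by
      rcases hchain x x.2 y y.2 with h | h
      · exact ⟨y, fun z hz => ⟨hz.1, h.trans hz.2⟩, subset_rfl⟩
      · exact ⟨x, subset_rfl, fun z hz => ⟨hz.1, h.trans hz.2⟩⟩)
    (fun x => (hSK x x.2).imp fun y hy => hy)
    (fun x => (hK.inter (isClosed_Ici _)).isCompact) (fun x => hK.inter (isClosed_Ici _))
  rw [Set.mem_iInter] at hy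
  exact ⟨y, (hy (Classical.arbitrary S)).1, fun x hx => (hy ⟨x, hx⟩).2⟩

/-- Zorn's lemma downwards: compactness provides lower bounds of nonempty chains. -/
theorem exists_isMin_le (x : X) : ∃ m, IsMin m ∧ m ≤ x := by
  obtain ⟨m, hm, hmin⟩ := zorn_le_nonempty_Ici₀ (α := Xᵒᵈ) (OrderDual.toDual x)
    (fun c _ hc y hy => by
      obtain ⟨z, -, hz⟩ := exists_lowerBound_mem (X := X) (K := Set.univ)
        (S := OrderDual.toDual ⁻¹' c) isClosed_univ ⟨OrderDual.ofDual y, hy⟩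
        (fun a ha b hb => (hc.total ha hb).symm) (fun a _ => ⟨a, trivial, le_rfl⟩)
      exact ⟨OrderDual.toDual z, fun a ha => hz (OrderDual.ofDual a) ha⟩)
    (OrderDual.toDual x) le_rfl
  exact ⟨OrderDual.ofDual m, fun y hy => hmin (b := OrderDual.toDual y) hy, hm⟩

end Priestley

/-! ### The chain of non-minimal points -/

section Chain

variable {X : Type*} [PartialOrder X] [TopologicalSpace X] [BiEsakiaSpace X]

/-- An order embedding of a finite poset can be thickened to clopen sets that respect the failures
of the order relation. -/
theorem exists_clopen_thickening {P : Type*} [PartialOrder P] [Finite P] (f : P → X)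
    (hf : ∀ p q, f p ≤ f q → p ≤ q) :
    ∃ N : P → Set X, (∀ p, IsClopen (N p)) ∧ (∀ p, f p ∈ N p) ∧
      ∀ p q, ¬ q ≤ p → Disjoint (N p) (up (N q)) := by
  have hS (q p : P) : ∃ S : Set X, IsClopen S ∧ IsUpperSet S ∧
      (¬ q ≤ p → f q ∈ S ∧ f p ∉ S) := by
    by_cases h : q ≤ p
    · exact ⟨Set.univ, isClopen_univ, isUpperSet_univ, fun h' => absurd h h'⟩
    · obtain ⟨U, hU, hup, hq, hp⟩ := exists_isClopen_upper_of_not_le fun h' => h (hf q p h')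
      exact ⟨U, hU, hup, fun _ => ⟨hq, hp⟩⟩
  choose S hSc hSu hSm using hS
  refine ⟨fun p => (⋂ q ∈ {q | ¬ q ≤ p}, (S q p)ᶜ) ∩ ⋂ q ∈ {q | ¬ p ≤ q}, S p q, fun p => ?_,
    fun p => ?_, fun p q hqp => ?_⟩
  · exact ((Set.toFinite _).isClopen_biInter fun q _ => (hSc q p).compl).inter
      ((Set.toFinite _).isClopen_biInter fun q _ => hSc p q)
  · exact ⟨Set.mem_iInter₂.2 fun q hq => (hSm q p hq).2,
      Set.mem_iInter₂.2 fun q hq => (hSm p q hq).1⟩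
  · rw [Set.disjoint_left]
    rintro x ⟨hx, -⟩ ⟨y, ⟨-, hy⟩, hyx⟩
    exact Set.mem_iInter₂.1 hx q hqp (hSu q p hyx (Set.mem_iInter₂.1 hy p hqp))

/-- Two incomparable non-minimal points, a point strictly below each, and the co-root form a copy of
`F0`, since upsets are chains. Thickened to clopen sets, this copy refutes `β(F0)`. -/
theorem le_total_of_not_isMin (hX : IsCoTree X) (hLFC : Validates X LFC) {b c : X}
    (hb : ¬ IsMin b) (hc : ¬ IsMin c) : b ≤ c ∨ c ≤ b := by
  by_contra! hbc
  obtain ⟨hbc, hcb⟩ := hbc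
  obtain ⟨r, hr⟩ := hX.exists_coroot
  obtain ⟨d, hd⟩ := not_isMin_iff.1 hb
  obtain ⟨e, he⟩ := not_isMin_iff.1 hc
  have tot (x y z : X) (hxy : x ≤ y) (hxz : x ≤ z) : y ≤ z ∨ z ≤ y :=
    (hX.isChain_up x).total hxy hxz
  have hdc : ¬ d ≤ c := fun h => (tot d b c hd.le h).elim hbc hcb
  have heb : ¬ e ≤ b := fun h => (tot e b c h he.le).elim hbc hcb
  let f : F0 → X
    | .a => r | .b => b | .c => c | .d => d | .e => e
  have hf (p q : F0) (h : f p ≤ f q) : p ≤ q := by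
    have hrb : ¬ r ≤ b := fun h => hcb ((hr c).trans h)
    have hrc : ¬ r ≤ c := fun h => hbc ((hr b).trans h)
    have hbd : ¬ b ≤ d := hd.not_ge
    have hce : ¬ c ≤ e := he.not_ge
    change F0.le p q = true
    cases p <;> cases q <;> first | rfl | exfalso
    all_goals dsimp only [f] at h
    all_goals first
      | exact hrb h | exact hrc h | exact hrb (h.trans hd.le) | exact hrc (h.trans he.le)
      | exact hbc h | exact hcb h | exact hbd h | exact hce h
      | exact hbc (h.trans he.le) | exact hcb (h.trans hd.le) | exact hdc h | exact heb h
      | exact hdc (h.trans he.le) | exact heb (h.trans hd.le)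
  obtain ⟨N, hNc, hNf, hN⟩ := exists_clopen_thickening f hf
  -- The thickening `N` controls only the failures of the order. Shrinking it from the bottom up
  -- forces each point of `W q` to lie above `W p` whenever `p ≤ q`, and keeps the original five
  -- points inside.
  let W : F0 → Set X
    | .a => N .a ∩ up (N .b ∩ up (N .d)) ∩ up (N .c ∩ up (N .e))
    | .b => N .b ∩ up (N .d)
    | .c => N .c ∩ up (N .e)
    | .d => N .d
    | .e => N .e
  have hWN (p) : W p ⊆ N p := by
    cases p
    · exact fun x hx => hx.1.1
    all_goals first | exact fun x hx => hx.1 | exact fun x hx => hx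
  have hbW : b ∈ W .b := ⟨hNf .b, d, hNf .d, hd.le⟩
  have hcW : c ∈ W .c := ⟨hNf .c, e, hNf .e, he.le⟩
  have refl (S : Set X) : S ⊆ up S := fun x hx => ⟨x, hx, le_rfl⟩
  refine not_refutes_of_mem hLFC (φ := subframeOf F0) (by simp)
    (refutes_subframe (P := WithDiscrete F0) hr W ?_ ?_ ?_ ?_)
  · intro p
    cases p
    · exact ((hNc _).inter (IsClopen.up ((hNc _).inter (IsClopen.up (hNc _))))).inter
        (IsClopen.up ((hNc _).inter (IsClopen.up (hNc _))))
    · exact (hNc _).inter (IsClopen.up (hNc _))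
    · exact (hNc _).inter (IsClopen.up (hNc _))
    · exact hNc _
    · exact hNc _
  · intro p
    cases p
    · exact ⟨r, ⟨hNf .a, b, hbW, hr b⟩, c, hcW, hr c⟩
    · exact ⟨b, hbW⟩
    · exact ⟨c, hcW⟩
    · exact ⟨d, hNf .d⟩
    · exact ⟨e, hNf .e⟩
  · intro p q hpq
    change F0.le p q = true at hpq
    cases p <;> cases q <;> first | exact refl _ | (exact absurd hpq (by decide)) | skip
    · exact fun x hx => hx.1.2
    · exact fun x hx => hx.2
    · rintro x ⟨⟨-, y, ⟨-, z, hz, hzy⟩, hyx⟩, -⟩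
      exact ⟨z, hz, hzy.trans hyx⟩
    · exact fun x hx => hx.2
    · rintro x ⟨-, y, ⟨-, z, hz, hzy⟩, hyx⟩
      exact ⟨z, hz, hzy.trans hyx⟩
    · exact fun x hx => hx.2
  · intro p q hqp
    refine (hN p q hqp).mono (hWN p) ?_
    rintro x ⟨y, hy, hyx⟩
    exact ⟨y, hWN q hy, hyx⟩

end Chain

/-! ### The position of the minimal points -/

section Teeth

variable {X : Type*} [PartialOrder X]

theorem not_isMin_of_le {x y : X} (hx : ¬ IsMin x) (hxy : x ≤ y) : ¬ IsMin y :=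
  fun h => hx (h.mono hxy)

theorem not_isMin_of_exists_notMem {V : Set X} {v : X} (hv : v ∈ V) (h : ∃ z ∉ V, z ≤ v) :
    ¬ IsMin v := by
  obtain ⟨z, hz, hzv⟩ := h
  intro hmin
  exact hz (hmin.eq_of_le hzv ▸ hv)

theorem isLowerSet_of_forall_isMin {S : Set X} (h : ∀ x ∈ S, IsMin x) : IsLowerSet S :=
  fun x _ hyx hx => (h x hx).eq_of_le hyx ▸ hx

variable [TopologicalSpace X] [BiEsakiaSpace X]

/-- Non-minimality of `c` spreads to a clopen upset: with `d < c` and a clopen upset `T` separating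
them, take the points of `T` that lie above a point outside `T`. -/
theorem exists_clopen_upset_not_isMin {c : X} (hc : ¬ IsMin c) :
    ∃ V : Set X, IsClopen V ∧ IsUpperSet V ∧ c ∈ V ∧ ∀ v ∈ V, ∃ z ∉ V, z ≤ v := by
  obtain ⟨d, hd⟩ := not_isMin_iff.1 hc
  obtain ⟨T, hT, hup, hcT, hdT⟩ := exists_isClopen_upper_of_not_le hd.not_ge
  refine ⟨T ∩ up Tᶜ, hT.inter (IsClopen.up hT.compl), hup.inter (isUpperSet_up _),
    ⟨hcT, d, hdT, hd.le⟩, ?_⟩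
  rintro v ⟨-, z, hz, hzv⟩
  exact ⟨z, fun h => hz h.1, hzv⟩

open Classical in
/-- Minimal points separate the non-minimal ones. -/
theorem exists_isMin_le_not_le (hX : IsCoTree X) (hLFC : Validates X LFC) {c c' : X}
    (hc : ¬ IsMin c) (hcc' : c < c') : ∃ m, IsMin m ∧ m ≤ c' ∧ ¬ m ≤ c := by
  by_contra! hno
  obtain ⟨r, hr⟩ := hX.exists_coroot
  have hc' : ¬ IsMin c' := not_isMin_of_le hc hcc'.le
  obtain ⟨S, hS, hSup, hc'S, hcS⟩ := exists_isClopen_upper_of_not_le hcc'.not_ge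
  obtain ⟨V, hV, hVup, hcV, hVz⟩ := exists_clopen_upset_not_isMin hc
  have hVmin (v) (hv : v ∈ V) : ¬ IsMin v := not_isMin_of_exists_notMem hv (hVz v hv)
  -- The level `N` contains `c`, and `E` contains `c'`. Together `L = ↓N` and `E` cover all
  -- non-minimal points, so the remainder `Q` consists of minimal points. `K` is the part of `E`
  -- above `Q`.
  obtain ⟨N, hNdef⟩ : ∃ N, N = V \ S := ⟨_, rfl⟩
  obtain ⟨L, hLdef⟩ : ∃ L, L = down N := ⟨_, rfl⟩
  obtain ⟨E, hEdef⟩ : ∃ E, E = S ∩ V := ⟨_, rfl⟩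
  obtain ⟨Q, hQdef⟩ : ∃ Q, Q = (L ∪ E)ᶜ := ⟨_, rfl⟩
  obtain ⟨K, hKdef⟩ : ∃ K, K = E ∩ up Q := ⟨_, rfl⟩
  have hN : IsClopen N := hNdef ▸ hV.diff hS
  have hL : IsClopen L := hLdef ▸ IsClopen.down hN
  have hE : IsClopen E := hEdef ▸ hS.inter hV
  have hQ : IsClopen Q := hQdef ▸ (hL.union hE).compl
  have hK : IsClopen K := hKdef ▸ hE.inter (IsClopen.up hQ)
  have hEup : IsUpperSet E := hEdef ▸ hSup.inter hVup
  have hKup : IsUpperSet K := hKdef ▸ hEup.inter (isUpperSet_up _)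
  have hcN : c ∈ N := hNdef ▸ ⟨hcV, hcS⟩
  have hc'E : c' ∈ E := hEdef ▸ ⟨hc'S, hVup hcc'.le hcV⟩
  have hNL (x) (hx : x ∈ N) : x ∈ L := hLdef ▸ ⟨x, hx, le_rfl⟩
  have hLlow (x y) (hxy : x ≤ y) (hy : y ∈ L) : x ∈ L := by
    subst hLdef; exact isLowerSet_down N hxy hy
  have hLS (x) (hx : x ∈ L) : x ∉ S := by
    subst hLdef hNdef
    obtain ⟨n, hn, hxn⟩ := hx
    exact fun h => hn.2 (hSup hxn h)
  have hEL (x) (hx : x ∈ E) : x ∉ L := fun h => hLS x h (hEdef ▸ hx).1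
  have hNc' (n) (hn : n ∈ N) : n ≤ c' := by
    subst hNdef
    exact (le_total_of_not_isMin hX hLFC (hVmin n hn.1) hc').resolve_right
      fun h => hn.2 (hSup h hc'S)
  have hcover (x) (hx : ¬ IsMin x) : x ∈ L ∨ x ∈ E := by
    rcases le_total_of_not_isMin hX hLFC hx hc with h | h
    · exact Or.inl (hLlow x c h (hNL c hcN))
    · by_cases hxS : x ∈ S
      · exact Or.inr (hEdef ▸ ⟨hxS, hVup h hcV⟩)
      · exact Or.inl (hNL x (hNdef ▸ ⟨hVup h hcV, hxS⟩))
  have hQmin (x) (hx : x ∈ Q) : IsMin x := by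
    by_contra h
    subst hQdef
    exact hx (hcover x h)
  -- The assumption that no minimal point separates `c'` from `c` enters here: a point of `Q` below
  -- `c'` would be below `c`, hence in `L`.
  have hQc' (x) (hx : x ∈ Q) : ¬ x ≤ c' := fun h => by
    have := hLlow x c (hno x (hQmin x hx) h) (hNL c hcN)
    subst hQdef
    exact hx (Or.inl this)
  have hQLE (x) : x ∈ Q ↔ x ∉ L ∧ x ∉ E := by subst hQdef; simp
  have hLN (x) (hx : x ∈ L) : ∃ n ∈ N, x ≤ n := by subst hLdef; exact hx
  have hEc (x) (hx : x ∈ E) : c ≤ x := by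
    subst hEdef
    exact (le_total_of_not_isMin hX hLFC hc (hVmin x hx.2)).resolve_right
      fun h => hcS (hSup h hx.1)
  have hNdown (n) (hn : n ∈ N) : ∃ z ≤ n, z ∈ L ∧ z ∉ N ∧ z ∉ E := by
    have hnL := hNL n hn
    obtain ⟨z, hz, hzn⟩ := hVz n (hNdef ▸ hn).1
    have hzL := hLlow z n hzn hnL
    exact ⟨z, hzn, hzL, fun h => hz (hNdef ▸ h).1, fun h => hEL z h hzL⟩
  have hNup (n y) (hn : n ∈ N) (hny : n ≤ y) : y ∈ N ∨ y ∈ E := by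
    have hnV : n ∈ V := (hNdef ▸ hn).1
    by_cases hyS : y ∈ S
    · exact Or.inr (hEdef ▸ ⟨hyS, hVup hny hnV⟩)
    · exact Or.inl (hNdef ▸ ⟨hVup hny hnV, hyS⟩)
  have hLup (x y) (hx : x ∈ L) (hxy : x ≤ y) : y ∈ L ∨ y ∈ E := by
    by_cases hy : IsMin y
    · exact Or.inl (hy.eq_of_le hxy ▸ hx)
    · exact hcover y hy
  have hrE : r ∈ E := hEup (hr c') hc'E
  rcases Q.eq_empty_or_nonempty with hQe | ⟨q, hq⟩
  · have hLE (x) (hx : x ∉ E) : x ∈ L := by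
      by_contra h
      exact (Set.eq_empty_iff_forall_notMem.1 hQe x) ((hQLE x).2 ⟨h, hx⟩)
    -- With `Q` empty, `E`, `N` and the rest of `L` are the three levels of a quotient onto the
    -- chain `F1`.
    let f (x : X) : F1 := if x ∈ E then .a else if x ∈ N then .b else .c
    have fa (x) : f x = .a ↔ x ∈ E := by simp only [f]; split_ifs <;> grind
    have fb (x) : f x = .b ↔ x ∈ N := by
      have := hEL x
      have := hNL x
      simp only [f]; split_ifs <;> grind
    have fc (x) : f x = .c ↔ x ∉ E ∧ x ∉ N := by simp only [f]; split_ifs <;> grind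
    refine not_refutes_of_mem hLFC (φ := jankovOf F1) (by simp)
      (refutes_jankov (P := WithDiscrete F1) hr f ?_ ?_ ?_ ?_ ?_)
    · rintro (_ | _ | _)
      · convert hE using 1; ext x; exact fa x
      · convert hN using 1; ext x; exact fb x
      · convert (hE.union hN).compl using 1; ext x; exact (fc x).trans (by simp)
    · intro x y hxy
      change F1.le (f x) (f y) = true
      have h1 := fun h => hEup hxy h
      have h2 := hNup x y
      simp only [f]
      split_ifs <;> first | rfl | (exfalso; grind)
    · intro x p hp
      change F1.le (f x) p = true at hp
      cases p
      · exact ⟨r, hr x, (fa r).2 hrE⟩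
      · cases hfx : f x
        · rw [hfx] at hp; exact absurd hp (by decide)
        · exact ⟨x, le_rfl, hfx⟩
        · obtain ⟨n, hn, hxn⟩ := hLN x (hLE x ((fc x).1 hfx).1)
          exact ⟨n, hxn, (fb n).2 hn⟩
      · cases hfx : f x <;> rw [hfx] at hp
        · exact absurd hp (by decide)
        · exact absurd hp (by decide)
        · exact ⟨x, le_rfl, hfx⟩
    · intro x p hp
      change F1.le p (f x) = true at hp
      have hd (n) (hn : n ∈ N) : ∃ z ≤ n, f z = .c := by
        obtain ⟨z, hz, -, hzN, hzE⟩ := hNdown n hn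
        exact ⟨z, hz, (fc z).2 ⟨hzE, hzN⟩⟩
      cases hfx : f x <;> rw [hfx] at hp <;> cases p <;>
        first | exact absurd hp (by decide) | exact ⟨x, le_rfl, hfx⟩ | skip
      · exact ⟨c, hEc x ((fa x).1 hfx), (fb c).2 hcN⟩
      · obtain ⟨z, hz, hfz⟩ := hd c hcN
        exact ⟨z, hz.trans (hEc x ((fa x).1 hfx)), hfz⟩
      · exact hd x ((fb x).1 hfx)
    · rintro (_ | _ | _)
      · exact ⟨r, (fa r).2 hrE⟩
      · exact ⟨c, (fb c).2 hcN⟩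
      · obtain ⟨z, hz, -, hzN, hzE⟩ := hNdown c hcN
        exact ⟨z, (fc z).2 ⟨hzE, hzN⟩⟩
  · have hKE (x) : x ∈ K ↔ x ∈ E ∧ ∃ q ∈ Q, q ≤ x := by subst hKdef; rfl
    -- Since `Q` has no point below `c'`, the upset `K` starts strictly above `c'`, so `c'` survives
    -- in `E ∖ K`.
    have hc'K : c' ∉ K := fun h => by
      obtain ⟨q', hq', hle⟩ := ((hKE c').1 h).2
      exact hQc' q' hq' hle
    have hKc' (x) (hx : x ∈ K) : c' ≤ x := by
      have : x ∈ V := (hEdef ▸ ((hKE x).1 hx).1 : x ∈ S ∩ V).2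
      exact (le_total_of_not_isMin hX hLFC hc' (hVmin x this)).resolve_right
        fun h => hc'K (hKup h hx)
    have hrK : r ∈ K := (hKE r).2 ⟨hrE, q, hq, hr q⟩
    have hQup (x y) (hx : x ∈ Q) (hxy : x ≤ y) : y ∈ Q ∨ y ∈ K := by
      by_cases hy : IsMin y
      · exact Or.inl (hy.eq_of_le hxy ▸ hx)
      · refine Or.inr ((hKE y).2 ⟨(hcover y hy).resolve_left fun h => ?_, x, hx, hxy⟩)
        exact ((hQLE x).1 hx).1 (hLlow x y hxy h)
    -- With `Q` nonempty, `E` splits in two and `Q` becomes the extra minimal point of `F2`.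
    let f (x : X) : F2 := if x ∈ K then .a else if x ∈ E then .b else if x ∈ N then .c else
      if x ∈ L then .d else .a'
    have fa (x) : f x = .a ↔ x ∈ K := by simp only [f]; split_ifs <;> grind
    have fb (x) : f x = .b ↔ x ∈ E ∧ x ∉ K := by simp only [f]; split_ifs <;> grind
    have fc (x) : f x = .c ↔ x ∈ N := by
      have := hEL x
      have := hNL x
      have := hKE x
      simp only [f]; split_ifs <;> grind
    have fd (x) : f x = .d ↔ x ∈ L ∧ x ∉ N := by
      have := hEL x
      have := hKE x
      simp only [f]; split_ifs <;> grind
    have fa' (x) : f x = .a' ↔ x ∈ Q := by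
      have := hQLE x
      have := hNL x
      have := hKE x
      simp only [f]; split_ifs <;> grind
    have hd (n) (hn : n ∈ N) : ∃ z ≤ n, f z = .d := by
      obtain ⟨z, hz, hzL, hzN, -⟩ := hNdown n hn
      exact ⟨z, hz, (fd z).2 ⟨hzL, hzN⟩⟩
    have hfc' : f c' = .b := (fb c').2 ⟨hc'E, hc'K⟩
    have hfc : f c = .c := (fc c).2 hcN
    obtain ⟨d, hdc, hfd⟩ := hd c hcN
    refine not_refutes_of_mem hLFC (φ := jankovOf F2) (by simp)
      (refutes_jankov (P := WithDiscrete F2) hr f ?_ ?_ ?_ ?_ ?_)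
    · rintro (_ | _ | _ | _ | _)
      · convert hK using 1; ext x; exact fa x
      · convert hQ using 1; ext x; exact fa' x
      · convert hE.diff hK using 1; ext x; exact fb x
      · convert hN using 1; ext x; exact fc x
      · convert hL.diff hN using 1; ext x; exact fd x
    · intro x y hxy
      change F2.le (f x) (f y) = true
      have h1 := fun h => hEup hxy h
      have h2 := fun h => hKup hxy h
      have h3 := hNup x y
      have h4 := hLup x y
      have h5 := hQup x y
      have h6 := hQLE x
      have h7 := hQLE y
      have h8 := hKE x
      have h9 := hKE y
      have h10 := hNL y
      have h11 := hEL y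
      simp only [f]
      split_ifs <;> first | rfl | (exfalso; grind)
    · intro x p hp
      change F2.le (f x) p = true at hp
      have hc (h : x ∈ L) : ∃ y, x ≤ y ∧ f y = .c := by
        obtain ⟨n, hn, hxn⟩ := hLN x h
        exact ⟨n, hxn, (fc n).2 hn⟩
      cases hfx : f x <;> rw [hfx] at hp <;> cases p <;>
        first
        | exact absurd hp (by decide) | exact ⟨x, le_rfl, hfx⟩
        | exact ⟨r, hr x, (fa r).2 hrK⟩ | skip
      · exact ⟨c', hNc' x ((fc x).1 hfx), hfc'⟩
      · obtain ⟨n, hn, hxn⟩ := hLN x ((fd x).1 hfx).1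
        exact ⟨c', hxn.trans (hNc' n hn), hfc'⟩
      · exact hc ((fd x).1 hfx).1
    · intro x p hp
      change F2.le p (f x) = true at hp
      cases hfx : f x <;> rw [hfx] at hp <;> cases p <;>
        first | exact absurd hp (by decide) | exact ⟨x, le_rfl, hfx⟩ | skip
      · obtain ⟨q', hq', hle⟩ := ((hKE x).1 ((fa x).1 hfx)).2
        exact ⟨q', hle, (fa' q').2 hq'⟩
      · exact ⟨c', hKc' x ((fa x).1 hfx), hfc'⟩
      · exact ⟨c, hcc'.le.trans (hKc' x ((fa x).1 hfx)), hfc⟩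
      · exact ⟨d, hdc.trans (hcc'.le.trans (hKc' x ((fa x).1 hfx))), hfd⟩
      · exact ⟨c, hEc x ((fb x).1 hfx).1, hfc⟩
      · exact ⟨d, hdc.trans (hEc x ((fb x).1 hfx).1), hfd⟩
      · exact hd x ((fc x).1 hfx)
    · rintro (_ | _ | _ | _ | _)
      · exact ⟨r, (fa r).2 hrK⟩
      · exact ⟨q, (fa' q).2 hq⟩
      · exact ⟨c', hfc'⟩
      · exact ⟨c, hfc⟩
      · exact ⟨d, hfd⟩

open Classical in
/-- No clopen upset `G` has three pairwise disjoint clopen downsets as its complement, each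
containing a lower bound of `G`. -/
theorem no_three_clopen_downsets (hX : IsCoTree X) (hLFC : Validates X LFC) {G D E F : Set X}
    (hG : IsClopen G) (hGup : IsUpperSet G) (hGne : G.Nonempty) (hD : IsClopen D)
    (hDlow : IsLowerSet D) (hE : IsClopen E) (hElow : IsLowerSet E) (hF : IsClopen F)
    (hFlow : IsLowerSet F) (hGD : Disjoint G D) (hGE : Disjoint G E) (hGF : Disjoint G F)
    (hDE : Disjoint D E) (hDF : Disjoint D F) (hEF : Disjoint E F)
    (hcover : ∀ x, x ∈ G ∨ x ∈ D ∨ x ∈ E ∨ x ∈ F) {d e e' : X} (hd : d ∈ D) (he : e ∈ E)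
    (he' : e' ∈ F) (hGd : ∀ g ∈ G, d ≤ g ∧ e ≤ g ∧ e' ≤ g) : False := by
  rw [Set.disjoint_left] at hGD hGE hGF hDE hDF hEF
  obtain ⟨r, hr⟩ := hX.exists_coroot
  have hrG : r ∈ G := hGne.elim fun g hg => hGup (hr g) hg
  -- Collapsing `G` to the co-root and each downset to one minimal point gives a quotient onto `F3`;
  -- the points `d`, `e`, `e'` provide the lifts downwards.
  let f (x : X) : F3 := if x ∈ G then .a else if x ∈ D then .b else if x ∈ E then .c else .d
  have fa (x) : f x = .a ↔ x ∈ G := by simp only [f]; split_ifs <;> grind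
  have fb (x) : f x = .b ↔ x ∈ D := by simp only [f]; split_ifs <;> grind
  have fc (x) : f x = .c ↔ x ∈ E := by simp only [f]; split_ifs <;> grind
  have fd (x) : f x = .d ↔ x ∈ F := by
    have := hcover x
    simp only [f]; split_ifs <;> grind
  refine not_refutes_of_mem hLFC (φ := jankovOf F3) (by simp)
    (refutes_jankov (P := WithDiscrete F3) hr f ?_ ?_ ?_ ?_ ?_)
  · rintro (_ | _ | _ | _)
    · convert hG using 1; ext x; exact fa x
    · convert hD using 1; ext x; exact fb x
    · convert hE using 1; ext x; exact fc x
    · convert hF using 1; ext x; exact fd x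
  · intro x y hxy
    change F3.le (f x) (f y) = true
    have h1 := fun h => hGup hxy h
    have h2 := fun h => hDlow hxy h
    have h3 := fun h => hElow hxy h
    have h4 := fun h => hFlow hxy h
    have h5 := hcover y
    simp only [f]
    split_ifs <;> first | rfl | (exfalso; grind)
  · intro x p hp
    change F3.le (f x) p = true at hp
    cases hfx : f x <;> rw [hfx] at hp <;> cases p <;>
      first
      | exact absurd hp (by decide) | exact ⟨x, le_rfl, hfx⟩ | exact ⟨r, hr x, (fa r).2 hrG⟩
  · intro x p hp
    change F3.le p (f x) = true at hp
    cases hfx : f x <;> rw [hfx] at hp <;> cases p <;>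
      first | exact absurd hp (by decide) | exact ⟨x, le_rfl, hfx⟩ | skip
    · exact ⟨d, (hGd x ((fa x).1 hfx)).1, (fb d).2 hd⟩
    · exact ⟨e, (hGd x ((fa x).1 hfx)).2.1, (fc e).2 he⟩
    · exact ⟨e', (hGd x ((fa x).1 hfx)).2.2, (fd e').2 he'⟩
  · rintro (_ | _ | _ | _)
    · exact ⟨r, (fa r).2 hrG⟩
    · exact ⟨d, (fb d).2 hd⟩
    · exact ⟨e, (fc e).2 he⟩
    · exact ⟨e', (fd e').2 he'⟩

/-- Let `x` be the least non-minimal point of a clopen upset, and suppose that `x` is not the least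
non-minimal point of the space. Then at most one minimal point lies below `x` and below no smaller
non-minimal point. -/
theorem isMin_unique_below (hX : IsCoTree X) (hLFC : Validates X LFC) {G : Set X} {x c m m' : X}
    (hG : IsClopen G) (hGup : IsUpperSet G) (hx : ¬ IsMin x) (hxG : x ∈ G)
    (hleast : ∀ z ∈ G, ¬ IsMin z → x ≤ z) (hc : ¬ IsMin c) (hcx : c < x)
    (hm : IsMin m) (hmx : m ≤ x) (hmz : ∀ z, ¬ IsMin z → z < x → ¬ m ≤ z)
    (hm' : IsMin m') (hmx' : m' ≤ x) (hmz' : ∀ z, ¬ IsMin z → z < x → ¬ m' ≤ z) : m = m' := by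
  by_contra hne
  obtain ⟨V, hV, hVup, hxV, hVz⟩ := exists_clopen_upset_not_isMin hx
  obtain ⟨V', hV', hVup', hcV', hVz'⟩ := exists_clopen_upset_not_isMin hc
  obtain ⟨E, hE, -, hmE, hmE'⟩ := exists_isClopen_upper_or_lower_of_ne hne
  obtain ⟨U, hUdef⟩ : ∃ U, U = G ∩ V := ⟨_, rfl⟩
  have hU : IsClopen U := hUdef ▸ hG.inter hV
  have hUup : IsUpperSet U := hUdef ▸ hGup.inter hVup
  have hxU : x ∈ U := hUdef ▸ ⟨hxG, hxV⟩
  have hUmin (u) (hu : u ∈ U) : ¬ IsMin u := by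
    subst hUdef
    exact not_isMin_of_exists_notMem hu.2 (hVz u hu.2)
  have hUx (u) (hu : u ∈ U) : x ≤ u := hleast u (hUdef ▸ hu).1 (hUmin u hu)
  -- `D` absorbs every non-minimal point outside `U`. What remains outside `U ∪ D` is minimal, so
  -- any clopen splitting of it, here by `E`, yields downsets.
  obtain ⟨D, hDdef⟩ : ∃ D, D = down (V' \ U) := ⟨_, rfl⟩
  have hD : IsClopen D := hDdef ▸ IsClopen.down (hV'.diff hU)
  have hDlow : IsLowerSet D := hDdef ▸ isLowerSet_down _
  have hcD : c ∈ D := hDdef ▸ ⟨c, ⟨hcV', fun h => hcx.not_ge (hUx c h)⟩, le_rfl⟩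
  have hDU (y) (hy : y ∈ D) : y ∉ U := by
    subst hDdef
    obtain ⟨z, hz, hyz⟩ := hy
    exact fun h => hz.2 (hUup hyz h)
  have hcover (y) (hy : ¬ IsMin y) : y ∈ U ∨ y ∈ D := by
    rcases le_total_of_not_isMin hX hLFC hy hc with h | h
    · exact Or.inr (hDlow h hcD)
    · by_cases hyU : y ∈ U
      · exact Or.inl hyU
      · exact Or.inr (hDdef ▸ ⟨y, ⟨hVup' h hcV', hyU⟩, le_rfl⟩)
  -- A non-minimal point outside `U` is strictly below `x`, so a minimal point below no such point
  -- avoids `D`.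
  have hmD (m) (hmz : ∀ z, ¬ IsMin z → z < x → ¬ m ≤ z) : m ∉ D := by
    subst hDdef
    rintro ⟨z, ⟨hzV', hzU⟩, hmz''⟩
    have hz := not_isMin_of_exists_notMem hzV' (hVz' z hzV')
    rcases le_total_of_not_isMin hX hLFC hz hx with h | h
    · exact hmz z hz (lt_of_le_of_ne h fun h' => hzU (h' ▸ hxU)) hmz''
    · exact hzU (hUup h hxU)
  have hrest (y) (hy : y ∉ U) (hy' : y ∉ D) : IsMin y := by
    by_contra h
    exact (hcover y h).elim hy hy'
  refine no_three_clopen_downsets hX hLFC (G := U) (D := D) (E := (E \ U) \ D)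
    (F := (Eᶜ \ U) \ D) hU hUup ⟨x, hxU⟩ hD hDlow ((hE.diff hU).diff hD)
    (isLowerSet_of_forall_isMin fun y hy => hrest y hy.1.2 hy.2)
    ((hE.compl.diff hU).diff hD)
    (isLowerSet_of_forall_isMin fun y hy => hrest y hy.1.2 hy.2)
    ?_ ?_ ?_ ?_ ?_ ?_ ?_ hcD (e := m) ⟨⟨hmE, fun h => hUmin m h hm⟩, hmD m hmz⟩
    (e' := m') ⟨⟨hmE', fun h => hUmin m' h hm'⟩, hmD m' hmz'⟩
    fun g hg => ⟨hcx.le.trans (hUx g hg), hmx.trans (hUx g hg), hmx'.trans (hUx g hg)⟩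
  all_goals simp only [Set.disjoint_left, Set.mem_sdiff, Set.mem_compl_iff]
  all_goals grind

/-- At most two minimal points lie below the least non-minimal point. -/
theorem isMin_below_least (hX : IsCoTree X) (hLFC : Validates X LFC) {x m₁ m₂ m₃ : X}
    (hx : ¬ IsMin x) (hleast : ∀ z, ¬ IsMin z → x ≤ z) (h₁ : m₁ ≤ x) (h₂ : m₂ ≤ x) (h₃ : m₃ ≤ x)
    (hm₁ : IsMin m₁) (hm₂ : IsMin m₂) (hm₃ : IsMin m₃) (h₁₂ : m₁ ≠ m₂) :
    m₃ = m₁ ∨ m₃ = m₂ := by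
  by_contra! hne
  obtain ⟨U, hU, hUup, hxU, hUz⟩ := exists_clopen_upset_not_isMin hx
  have hUmin (u) (hu : u ∈ U) : ¬ IsMin u := not_isMin_of_exists_notMem hu (hUz u hu)
  have hUx (u) (hu : u ∈ U) : x ≤ u := hleast u (hUmin u hu)
  have hrest (y) (hy : y ∉ U) : IsMin y := by
    by_contra h
    exact hy (hUup (hleast y h) hxU)
  -- `D ∩ D'` separates `m₃` from `m₁` and `m₂`, and `E` separates those two from each other. All
  -- points outside `U` are minimal, so the three pieces are downsets.
  obtain ⟨D, hD, -, hmD₁, hmD₂⟩ := exists_isClopen_upper_or_lower_of_ne hne.1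
  obtain ⟨D', hD', -, hmD₁', hmD₂'⟩ := exists_isClopen_upper_or_lower_of_ne hne.2
  obtain ⟨E, hE, -, hmE₁, hmE₂⟩ := exists_isClopen_upper_or_lower_of_ne h₁₂
  refine no_three_clopen_downsets hX hLFC (G := U) (D := (D ∩ D') \ U)
    (E := (E \ (D ∩ D')) \ U) (F := (Eᶜ \ (D ∩ D')) \ U) hU hUup ⟨x, hxU⟩
    ((hD.inter hD').diff hU) (isLowerSet_of_forall_isMin fun y hy => hrest y hy.2)
    ((hE.diff (hD.inter hD')).diff hU) (isLowerSet_of_forall_isMin fun y hy => hrest y hy.2)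
    ((hE.compl.diff (hD.inter hD')).diff hU)
    (isLowerSet_of_forall_isMin fun y hy => hrest y hy.2)
    ?_ ?_ ?_ ?_ ?_ ?_ ?_ (d := m₃) ⟨⟨hmD₁, hmD₁'⟩, fun h => hUmin _ h hm₃⟩
    (e := m₁) ⟨⟨hmE₁, fun h => hmD₂ h.1⟩, fun h => hUmin _ h hm₁⟩
    (e' := m₂) ⟨⟨hmE₂, fun h => hmD₂' h.2⟩, fun h => hUmin _ h hm₂⟩
    fun g hg => ⟨h₃.trans (hUx g hg), h₁.trans (hUx g hg), h₂.trans (hUx g hg)⟩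
  all_goals simp only [Set.disjoint_left, Set.mem_sdiff, Set.mem_compl_iff, Set.mem_inter_iff]
  all_goals grind

/-! ### Extremal witnesses -/

theorem exists_greatest_not_isMin (hX : IsCoTree X) (hLFC : Validates X LFC) {W : Set X}
    (hW : IsClopen W) {z : X} (hzW : z ∈ W) (hz : ¬ IsMin z) :
    ∃ g ∈ W, ¬ IsMin g ∧ ∀ y ∈ W, ¬ IsMin y → y ≤ g := by
  obtain ⟨g, hg, hgle⟩ := exists_upperBound_mem (K := W) (S := {y | y ∈ W ∧ ¬ IsMin y})
    hW.isClosed ⟨z, hzW, hz⟩ (fun x hx y hy => le_total_of_not_isMin hX hLFC hx.2 hy.2)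
    (fun x hx => ⟨x, hx.1, le_rfl⟩)
  exact ⟨g, hg, not_isMin_of_le hz (hgle z ⟨hzW, hz⟩), fun y hy hy' => hgle y ⟨hy, hy'⟩⟩

/-- Compactness yields a lower bound in `up W` of the non-minimal points there, but it might be
minimal. If a non-minimal `y₀` lies outside `up W`, searching above `y₀` avoids this. Otherwise `up
W` contains all non-minimal points, and a minimal bound in `up W` must belong to `W` itself. -/
theorem exists_least_not_isMin (hX : IsCoTree X) (hLFC : Validates X LFC) {W : Set X}
    (hW : IsClopen W) {z : X} (hzW : z ∈ up W) (hz : ¬ IsMin z) :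
    (∃ g ∈ up W, ¬ IsMin g ∧ ∀ y ∈ up W, ¬ IsMin y → g ≤ y) ∨
      (¬ ∃ x : X, ¬ IsMin x ∧ ∀ y, ¬ IsMin y → x ≤ y) ∧
        ∃ i ∈ W, IsMin i ∧ ∀ y, ¬ IsMin y → i ≤ y := by
  have tot := @le_total_of_not_isMin X _ _ _ hX hLFC
  by_cases h : ∃ y, ¬ IsMin y ∧ y ∉ up W
  · obtain ⟨y₀, hy₀, hy₀W⟩ := h
    have hle (y) (hy : y ∈ up W) (hy' : ¬ IsMin y) : y₀ ≤ y :=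
      (tot hy₀ hy').resolve_right fun h => hy₀W (isUpperSet_up W h hy)
    obtain ⟨g, hg, hgle⟩ := exists_lowerBound_mem (K := up W ∩ Set.Ici y₀)
      (S := {y | y ∈ up W ∧ ¬ IsMin y}) ((IsClopen.up hW).isClosed.inter (isClosed_Ici y₀))
      ⟨z, hzW, hz⟩ (fun x hx y hy => tot hx.2 hy.2)
      (fun x hx => ⟨x, ⟨hx.1, hle x hx.1 hx.2⟩, le_rfl⟩)
    exact Or.inl ⟨g, hg.1, not_isMin_of_le hy₀ hg.2, fun y hy hy' => hgle y ⟨hy, hy'⟩⟩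
  · push Not at h
    by_cases hleast : ∃ x : X, ¬ IsMin x ∧ ∀ y, ¬ IsMin y → x ≤ y
    · obtain ⟨x, hx, hxle⟩ := hleast
      exact Or.inl ⟨x, h x hx, hx, fun y _ hy => hxle y hy⟩
    · obtain ⟨i, hi, hile⟩ := exists_lowerBound_mem (K := up W) (S := {y | ¬ IsMin y})
        (IsClopen.up hW).isClosed ⟨z, hz⟩ (fun x hx y hy => tot hx hy)
        (fun x hx => ⟨x, h x hx, le_rfl⟩)
      have himin : IsMin i := by
        by_contra h'
        exact hleast ⟨i, h', hile⟩
      obtain ⟨w, hw, hwi⟩ := hi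
      exact Or.inr ⟨hleast, i, himin.eq_of_le hwi ▸ hw, himin, hile⟩

/-- If a clopen upset `V` separated two such bounds, every non-minimal point would lie in the closed
set `V ∩ up Vᶜ`. By compactness that set would contain a lower bound of them, itself non-minimal,
hence a least non-minimal point. -/
theorem isMin_lowerBound_unique (hX : IsCoTree X) (hLFC : Validates X LFC) {i j z : X}
    (hz : ¬ IsMin z) (hleast : ¬ ∃ x : X, ¬ IsMin x ∧ ∀ y, ¬ IsMin y → x ≤ y)
    (hj : IsMin j) (hile : ∀ y, ¬ IsMin y → i ≤ y)
    (hjle : ∀ y, ¬ IsMin y → j ≤ y) : i = j := by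
  by_contra hne
  obtain ⟨V, hV, hVup, hiV, hjV⟩ :=
    exists_isClopen_upper_of_not_le fun h : i ≤ j => hne (hj.eq_of_le h)
  obtain ⟨x, hx, hxle⟩ := exists_lowerBound_mem (K := V ∩ up Vᶜ) (S := {y | ¬ IsMin y})
    (hV.inter (IsClopen.up hV.compl)).isClosed ⟨z, hz⟩
    (fun x hx y hy => le_total_of_not_isMin hX hLFC hx hy)
    (fun x hx => ⟨x, ⟨hVup (hile x hx) hiV, j, hjV, hjle x hx⟩, le_rfl⟩)
  obtain ⟨w, hw, hwx⟩ := hx.2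
  exact hleast ⟨x, not_isMin_of_exists_notMem hx.1 ⟨w, hw, hwx⟩, hxle⟩

end Teeth

/-! ### Combs as subposets -/

section Combs

variable {X : Type*} [PartialOrder X]

theorem nonempty_orderIso_of_forall_mem_iff {P : Type*} [PartialOrder P] {Y : Finset X} (f : P → X)
    (hf : ∀ a b, f a ≤ f b ↔ a ≤ b) (hY : ∀ x, x ∈ Y ↔ ∃ a, f a = x) :
    Nonempty ({x : X // x ∈ Y} ≃o P) := by
  let g : P ↪o {x : X // x ∈ Y} :=
    OrderEmbedding.ofMapLEIff (fun a => ⟨f a, (hY _).2 ⟨a, rfl⟩⟩) hf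
  refine ⟨(RelIso.ofSurjective g ?_).symm⟩
  rintro ⟨x, hx⟩
  obtain ⟨a, rfl⟩ := (hY x).1 hx
  exact ⟨a, rfl⟩

open Classical in
theorem exists_strictMono_enumeration (S : Finset X) (hS : ∀ x ∈ S, ∀ y ∈ S, x ≤ y ∨ y ≤ x) :
    ∃ e : Fin S.card → X, StrictMono e ∧ ∀ x, x ∈ S ↔ ∃ i, e i = x := by
  let _ : LinearOrder {x // x ∈ S} :=
    { (inferInstance : PartialOrder {x // x ∈ S}) with
      le_total := fun x y => hS x x.2 y y.2
      toDecidableLE := Classical.decRel _ }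
  let e := monoEquivOfFin {x // x ∈ S} (Fintype.card_coe S)
  refine ⟨fun i => e i, fun i j hij => e.strictMono hij, fun x => ⟨fun hx => ?_, ?_⟩⟩
  · exact ⟨e.symm ⟨x, hx⟩, by simp⟩
  · rintro ⟨i, rfl⟩
    exact (e i).2

variable {S : Finset X} {t : X → X}

open Classical in
-- On the chain `S`, `hle` and `hnle` say that `t y ≤ y'` exactly when `y ≤ y'`; this is the order
-- of a comb and forces the teeth to be distinct.
theorem nonempty_orderIso_comb (hne : S.Nonempty) (hS : ∀ x ∈ S, ∀ y ∈ S, x ≤ y ∨ y ≤ x)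
    (hSmin : ∀ x ∈ S, ¬ IsMin x) (ht : ∀ y ∈ S, IsMin (t y)) (hle : ∀ y ∈ S, t y ≤ y)
    (hnle : ∀ y ∈ S, ∀ y' ∈ S, y' < y → ¬ t y ≤ y') :
    ∃ k : ℕ, 0 < k ∧ Nonempty ({x : X // x ∈ S ∪ S.image t} ≃o Comb k) := by
  obtain ⟨e, he, hmem⟩ := exists_strictMono_enumeration S hS
  have heS (i) : e i ∈ S := (hmem _).2 ⟨i, rfl⟩
  have hts (i j) : t (e i) ≤ e j ↔ i ≤ j := by
    constructor
    · intro h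
      by_contra! hij
      exact hnle _ (heS i) _ (heS j) (he hij) h
    · exact fun h => (hle _ (heS i)).trans (he.monotone h)
  refine ⟨S.card, hne.card_pos, nonempty_orderIso_of_forall_mem_iff
    (fun | .spine i => e i | .tooth i => t (e i)) ?_ ?_⟩
  · rintro (i | i) (j | j)
    · exact he.le_iff_le
    · exact iff_of_false (fun h => hSmin _ (heS i) ((ht _ (heS j)).mono h)) id
    · exact hts i j
    · refine ⟨fun h => ?_, fun h => (congrArg (t ∘ e) (show i = j from h)).le⟩
      have heq : t (e i) = t (e j) := (ht _ (heS j)).eq_of_le h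
      exact le_antisymm ((hts i j).1 (heq ▸ hle _ (heS j)))
        ((hts j i).1 (heq ▸ hle _ (heS i)))
  · intro x
    rw [Finset.mem_union, Finset.mem_image]
    constructor
    · rintro (hx | ⟨y, hy, rfl⟩)
      · obtain ⟨i, rfl⟩ := (hmem x).1 hx
        exact ⟨.spine i, rfl⟩
      · obtain ⟨i, rfl⟩ := (hmem y).1 hy
        exact ⟨.tooth i, rfl⟩
    · rintro ⟨i | i, rfl⟩
      · exact Or.inl (heS i)
      · exact Or.inr ⟨e i, heS i, rfl⟩

open Classical in
theorem nonempty_orderIso_hcomb {s : X} (hS : ∀ x ∈ S, ∀ y ∈ S, x ≤ y ∨ y ≤ x)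
    (hSmin : ∀ x ∈ S, ¬ IsMin x) (ht : ∀ y ∈ S, IsMin (t y)) (hle : ∀ y ∈ S, t y ≤ y)
    (hnle : ∀ y ∈ S, ∀ y' ∈ S, y' < y → ¬ t y ≤ y') (hs : IsMin s) (hsle : ∀ y ∈ S, s ≤ y)
    (hst : ∀ y ∈ S, t y ≠ s) :
    ∃ k : ℕ, Nonempty ({x : X // x ∈ insert s (S ∪ S.image t)} ≃o HComb k) := by
  obtain ⟨e, he, hmem⟩ := exists_strictMono_enumeration S hS
  have heS (i) : e i ∈ S := (hmem _).2 ⟨i, rfl⟩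
  have hts (i j) : t (e i) ≤ e j ↔ i ≤ j := by
    constructor
    · intro h
      by_contra! hij
      exact hnle _ (heS i) _ (heS j) (he hij) h
    · exact fun h => (hle _ (heS i)).trans (he.monotone h)
  -- The handle end `s` takes the place of `y_0` and the chain is shifted by one, so that tooth `i`
  -- hangs at spine point `i + 1`.
  let f : HComb S.card → X
    | .spine i => Fin.cases s e i
    | .tooth i => t (e i)
  have hf0 : f (.spine 0) = s := rfl
  have hfs (i) : f (.spine (Fin.succ i)) = e i := rfl
  have hft (i) : f (.tooth i) = t (e i) := rfl
  refine ⟨S.card, nonempty_orderIso_of_forall_mem_iff f ?_ ?_⟩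
  · rintro (i | i) (j | j)
    · change _ ↔ i ≤ j
      induction i using Fin.cases with
      | zero =>
        refine iff_of_true ?_ (Fin.zero_le j)
        induction j using Fin.cases with
        | zero => exact le_rfl
        | succ j => exact hsle _ (heS j)
      | succ i =>
        induction j using Fin.cases with
        | zero =>
          exact iff_of_false (fun h => hSmin _ (heS i) (hs.mono h)) (by simp)
        | succ j => rw [hfs, hfs, he.le_iff_le, Fin.succ_le_succ_iff]
    · refine iff_of_false ?_ id
      rw [hft]
      induction i using Fin.cases with
      | zero => exact fun h => hst _ (heS j) ((ht _ (heS j)).eq_of_le h).symm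
      | succ i => exact fun h => hSmin _ (heS i) ((ht _ (heS j)).mono h)
    · change _ ↔ i.succ ≤ j
      rw [hft]
      induction j using Fin.cases with
      | zero => exact iff_of_false (fun h => hst _ (heS i) (hs.eq_of_le h)) (by simp)
      | succ j => rw [hfs, hts, Fin.succ_le_succ_iff]
    · refine ⟨fun h => ?_, fun h => (congrArg (t ∘ e) (show i = j from h)).le⟩
      have heq : t (e i) = t (e j) := (ht _ (heS j)).eq_of_le h
      exact le_antisymm ((hts i j).1 (heq ▸ hle _ (heS j)))
        ((hts j i).1 (heq ▸ hle _ (heS i)))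
  · intro x
    rw [Finset.mem_insert, Finset.mem_union, Finset.mem_image]
    constructor
    · rintro (rfl | hx | ⟨y, hy, rfl⟩)
      · exact ⟨.spine 0, hf0⟩
      · obtain ⟨i, rfl⟩ := (hmem x).1 hx
        exact ⟨.spine i.succ, hfs i⟩
      · obtain ⟨i, rfl⟩ := (hmem y).1 hy
        exact ⟨.tooth i, rfl⟩
    · rintro ⟨i | i, rfl⟩
      · induction i using Fin.cases with
        | zero => exact Or.inl rfl
        | succ i => exact Or.inr (Or.inl (heS i))
      · exact Or.inr (Or.inr ⟨e i, heS i, rfl⟩)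

end Combs

/-! ### Selective filtration -/

section Filtration

variable {X : Type*} [PartialOrder X]

/-- `Y` contains witnesses for all sets in `F`. -/
def IsSelective (Y : Set X) (F : Set (Set X)) : Prop :=
  ∀ W ∈ F, ∀ x ∈ Y, (∀ z ∈ W, x ≤ z → ∃ y ∈ Y, y ∈ W ∧ x ≤ y) ∧
    ∀ z ∈ W, z ≤ x → ∃ y ∈ Y, y ∈ W ∧ y ≤ x

theorem IsSelective.mono {Y : Set X} {F F' : Set (Set X)} (h : IsSelective Y F) (hF : F' ⊆ F) :
    IsSelective Y F' := fun W hW => h W (hF hW)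

variable [TopologicalSpace X] [BiEsakiaSpace X]

/-- The sets of points witnessing the truth of the co-implications and the falsity of the
implications that occur in a formula. -/
def witnessSets (v : ℕ → ClopenUpperSet X) : Fm → Set (Set X)
  | .var _ => ∅
  | .top => ∅
  | .bot => ∅
  | .and φ ψ => witnessSets v φ ∪ witnessSets v ψ
  | .or φ ψ => witnessSets v φ ∪ witnessSets v ψ
  | .imp φ ψ => insert {x | x ∈ φ.eval v ∧ x ∉ ψ.eval v}
      (witnessSets v φ ∪ witnessSets v ψ)
  | .coimp φ ψ => insert {x | x ∈ φ.eval v ∧ x ∉ ψ.eval v}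
      (witnessSets v φ ∪ witnessSets v ψ)

theorem finite_witnessSets (v : ℕ → ClopenUpperSet X) (φ : Fm) : (witnessSets v φ).Finite := by
  induction φ with
  | var | top | bot => exact Set.finite_empty
  | and φ ψ hφ hψ | or φ ψ hφ hψ => exact hφ.union hψ
  | imp φ ψ hφ hψ | coimp φ ψ hφ hψ => exact (hφ.union hψ).insert _

theorem isClopen_of_mem_witnessSets (v : ℕ → ClopenUpperSet X) (φ : Fm) {W : Set X}
    (hW : W ∈ witnessSets v φ) : IsClopen W := by
  induction φ with
  | var | top | bot => exact hW.elim
  | and φ ψ hφ hψ | or φ ψ hφ hψ => exact hW.elim hφ hψ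
  | imp φ ψ hφ hψ | coimp φ ψ hφ hψ =>
    rcases hW with rfl | hW | hW
    · exact (φ.eval v).isClopen.diff (ψ.eval v).isClopen
    · exact hφ hW
    · exact hψ hW

variable {Z : Type*} [PartialOrder Z] [TopologicalSpace Z] [BiEsakiaSpace Z] [DiscreteTopology Z]

/-- The restriction of a valuation along an order embedding of a discrete space. -/
def restrictValuation (e : Z ↪o X) (v : ℕ → ClopenUpperSet X) (n : ℕ) : ClopenUpperSet Z :=
  ⟨⟨e ⁻¹' (v n : Set X), isClopen_discrete _⟩, fun _ _ h hx => (v n).upper (e.monotone h) hx⟩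

/-- Only `→` and `←` look at other points. The upward clause of selectivity supplies a
counterexample to an implication that fails in `X`, the downward clause a witness of a
co-implication that holds in `X`; the converse directions need only the embedding. -/
theorem mem_eval_restrictValuation (e : Z ↪o X) (v : ℕ → ClopenUpperSet X) (φ : Fm)
    (h : IsSelective (Set.range e) (witnessSets v φ)) (z : Z) :
    z ∈ φ.eval (restrictValuation e v) ↔ e z ∈ φ.eval v := by
  induction φ generalizing z with
  | var n => rfl
  | top => exact iff_of_true mem_top mem_top
  | bot => exact iff_of_false not_mem_bot not_mem_bot
  | and φ ψ hφ hψ =>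
    exact and_congr (hφ (h.mono Set.subset_union_left) z) (hψ (h.mono Set.subset_union_right) z)
  | or φ ψ hφ hψ =>
    exact or_congr (hφ (h.mono Set.subset_union_left) z) (hψ (h.mono Set.subset_union_right) z)
  | imp φ ψ hφ hψ =>
    replace hφ := hφ (h.mono (Set.subset_union_left.trans (Set.subset_insert _ _)))
    replace hψ := hψ (h.mono (Set.subset_union_right.trans (Set.subset_insert _ _)))
    rw [Fm.eval, Fm.eval, mem_himp, mem_himp]
    constructor
    · intro H x hzx hx
      by_contra hx'
      obtain ⟨_, ⟨y, rfl⟩, hy, hzy⟩ :=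
        (h _ (Set.mem_insert _ _) (e z) ⟨z, rfl⟩).1 x ⟨hx, hx'⟩ hzx
      exact hy.2 ((hψ y).1 (H y (e.le_iff_le.1 hzy) ((hφ y).2 hy.1)))
    · intro H y hzy hy
      exact (hψ y).2 (H (e y) (e.le_iff_le.2 hzy) ((hφ y).1 hy))
  | coimp φ ψ hφ hψ =>
    replace hφ := hφ (h.mono (Set.subset_union_left.trans (Set.subset_insert _ _)))
    replace hψ := hψ (h.mono (Set.subset_union_right.trans (Set.subset_insert _ _)))
    rw [Fm.eval, Fm.eval, mem_sdiff, mem_sdiff]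
    constructor
    · rintro ⟨y, hyz, hyφ, hyψ⟩
      exact ⟨e y, e.le_iff_le.2 hyz, (hφ y).1 hyφ, fun h' => hyψ ((hψ y).2 h')⟩
    · rintro ⟨x, hxz, hxφ, hxψ⟩
      obtain ⟨_, ⟨y, rfl⟩, hy, hyz⟩ :=
        (h _ (Set.mem_insert _ _) (e z) ⟨z, rfl⟩).2 x ⟨hxφ, hxψ⟩ hxz
      exact ⟨y, e.le_iff_le.1 hyz, (hφ y).2 hy.1, fun h' => hy.2 ((hψ y).1 h')⟩

theorem refutes_of_isSelective {v : ℕ → ClopenUpperSet X} {φ : Fm} {Y : Finset X}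
    (h : IsSelective (Y : Set X) (insert {x | x ∉ φ.eval v} (witnessSets v φ))) {r : X}
    (hr : ∀ x, x ≤ r) (hrY : r ∈ Y) (hφ : φ.eval v ≠ ⊤) :
    Refutes (WithDiscrete {x : X // x ∈ Y}) φ := by
  let e : WithDiscrete {x : X // x ∈ Y} ↪o X := OrderEmbedding.subtype fun x => x ∈ Y
  have he : Set.range e = (Y : Set X) := Subtype.range_coe
  obtain ⟨x, hx⟩ : ∃ x, x ∉ φ.eval v := by
    by_contra! hall
    exact hφ (eq_top_of_forall_mem hall)
  -- The set of points refuting `φ` was added to the family so that selectivity at the co-root puts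
  -- one of them into `Y`.
  obtain ⟨y, hyY, hy, -⟩ := (h _ (Set.mem_insert _ _) r hrY).2 x hx (hr x)
  obtain ⟨z, rfl⟩ : y ∈ Set.range e := he ▸ hyY
  refine ⟨restrictValuation e v, fun htop => hy ?_⟩
  refine (mem_eval_restrictValuation e v φ ?_ z).1 (htop ▸ mem_top)
  rw [he]
  exact h.mono (Set.subset_insert _ _)

end Filtration

/-! ### Selecting a comb -/

section Selection

variable {X : Type*} [PartialOrder X] [TopologicalSpace X] [BiEsakiaSpace X]

/-- If `y` is the least non-minimal point of `up W` but `y ∉ W`, a witness in `W` below `y` is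
minimal and below no smaller non-minimal point. Such a minimal point is unique by
`isMin_unique_below`, so one tooth serves all these `W`. -/
theorem exists_tooth (hX : IsCoTree X) (hLFC : Validates X LFC) {F : Set (Set X)}
    (hF : ∀ W ∈ F, IsClopen W) {S : Finset X} (hS : ∀ x ∈ S, ¬ IsMin x) {c y : X} (hy : ¬ IsMin y)
    (hc : c ∈ S) (hcy : c < y) :
    ∃ t, IsMin t ∧ t ≤ y ∧ (∀ y' ∈ S, y' < y → ¬ t ≤ y') ∧
      ∀ W ∈ F, y ∈ up W → (∀ z ∈ up W, ¬ IsMin z → y ≤ z) → y ∉ W → t ∈ W := by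
  classical
  have key {W : Set X} (hleast : ∀ z ∈ up W, ¬ IsMin z → y ≤ z) (hyW : y ∉ W) {w : X}
      (hw : w ∈ W) (hwy : w ≤ y) : IsMin w ∧ ∀ z, ¬ IsMin z → z < y → ¬ w ≤ z := by
    constructor
    · by_contra hmin
      exact hyW (le_antisymm hwy (hleast w ⟨w, hw, le_rfl⟩ hmin) ▸ hw)
    · exact fun z hz hzy hwz => hzy.not_ge (hleast z ⟨w, hw, hwz⟩ hz)
  by_cases h : ∃ W ∈ F, y ∈ up W ∧ (∀ z ∈ up W, ¬ IsMin z → y ≤ z) ∧ y ∉ W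
  · obtain ⟨W, hWF, hyup, hleast, hyW⟩ := h
    obtain ⟨w, hw, hwy⟩ := id hyup
    obtain ⟨hwmin, hwz⟩ := key hleast hyW hw hwy
    refine ⟨w, hwmin, hwy, fun y' hy' => hwz y' (hS y' hy'), ?_⟩
    rintro W' - ⟨w', hw', hwy'⟩ hleast' hyW'
    obtain ⟨hwmin', hwz'⟩ := key hleast' hyW' hw' hwy'
    rw [isMin_unique_below hX hLFC (IsClopen.up (hF W hWF)) (isUpperSet_up W) hy hyup hleast
      (hS c hc) hcy hwmin hwy hwz hwmin' hwy' hwz']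
    exact hw'
  -- No set prescribes the tooth, so any minimal point separating `y` from its predecessor `d` in
  -- `S` will do.
  · obtain ⟨d, hd⟩ := (S.filter (· < y)).exists_maximal ⟨c, by simp [hc, hcy]⟩
    have hdS := Finset.mem_filter.1 hd.prop
    obtain ⟨t, ht, hty, htd⟩ := exists_isMin_le_not_le hX hLFC (hS d hdS.1) hdS.2
    refine ⟨t, ht, hty, fun y' hy' hlt hle => htd (hle.trans ?_), fun W hW h₁ h₂ h₃ =>
      absurd ⟨W, hW, h₁, h₂, h₃⟩ h⟩
    rcases le_total_of_not_isMin hX hLFC (hS y' hy') (hS d hdS.1) with h' | h'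
    · exact h'
    · exact hd.le_of_ge (Finset.mem_filter.2 ⟨hy', hlt⟩) h'

/-- A finite chain of non-minimal points that contains the extremal witnesses, together with the
minimal points required below its least element, extends to a selective comb. -/
theorem exists_selective_comb_of_chain (hX : IsCoTree X) (hLFC : Validates X LFC)
    {F : Set (Set X)} (hF : ∀ W ∈ F, IsClopen W) {S : Finset X} (hS : ∀ x ∈ S, ¬ IsMin x)
    (hup : ∀ W ∈ F, ∀ z ∈ W, ¬ IsMin z → ∃ g ∈ S, g ∈ W ∧ z ≤ g) {c m s : X} (hcS : c ∈ S)
    (hc : ∀ y ∈ S, c ≤ y) (hm : IsMin m) (hmc : m ≤ c) (hs : IsMin s) (hsc : s ≤ c)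
    (hdown : ∀ W ∈ F, ∀ z ∈ up W, ¬ IsMin z →
      (∃ g ∈ S, g ≠ c ∧ g ∈ up W ∧ ∀ y ∈ up W, ¬ IsMin y → g ≤ y) ∨
        ∃ w ∈ W, (w = c ∨ w = m ∨ w = s) ∧ w ≤ z) :
    ∃ Y : Finset X, (∀ x ∈ S, x ∈ Y) ∧ IsSelective (Y : Set X) F ∧
      ((∃ k : ℕ, 0 < k ∧ Nonempty ({x : X // x ∈ Y} ≃o Comb k)) ∨
        ∃ k : ℕ, Nonempty ({x : X // x ∈ Y} ≃o HComb k)) := by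
  classical
  -- The least spine point `c` has the prescribed tooth `m`, because uniqueness of teeth is not
  -- available there. Off `S` the value is irrelevant.
  have htooth (y : X) : ∃ t, y ∈ S → IsMin t ∧ t ≤ y ∧ (∀ y' ∈ S, y' < y → ¬ t ≤ y') ∧
      (y = c → t = m) ∧ (y ≠ c →
        ∀ W ∈ F, y ∈ up W → (∀ z ∈ up W, ¬ IsMin z → y ≤ z) → y ∉ W → t ∈ W) := by
    by_cases hyS : y ∈ S
    · by_cases hyc : y = c
      · refine ⟨m, fun _ => ⟨hm, hyc ▸ hmc, fun y' hy' hlt => ?_, fun _ => rfl,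
          fun h => absurd hyc h⟩⟩
        exact absurd (hc y' hy') (hyc ▸ hlt).not_ge
      · obtain ⟨t, h₁, h₂, h₃, h₄⟩ := exists_tooth hX hLFC hF hS (hS y hyS) hcS
          (lt_of_le_of_ne (hc y hyS) (Ne.symm hyc))
        exact ⟨t, fun _ => ⟨h₁, h₂, h₃, fun h => absurd h hyc, fun _ => h₄⟩⟩
    · exact ⟨y, fun h => absurd h hyS⟩
  choose t ht using htooth
  have htc : t c = m := (ht c hcS).2.2.2.1 rfl
  have hchain : ∀ x ∈ S, ∀ y ∈ S, x ≤ y ∨ y ≤ x := fun x hx y hy =>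
    le_total_of_not_isMin hX hLFC (hS x hx) (hS y hy)
  refine ⟨insert s (S ∪ S.image t), fun x hx => by simp [hx], fun W hW x hx => ⟨?_, ?_⟩, ?_⟩
  · intro z hz hxz
    by_cases hzmin : IsMin z
    · exact ⟨x, hx, hzmin.eq_of_le hxz ▸ hz, le_rfl⟩
    · obtain ⟨g, hg, hgW, hzg⟩ := hup W hW z hz hzmin
      exact ⟨g, by simp [hg], hgW, hxz.trans hzg⟩
  · intro z hz hzx
    by_cases hxmin : IsMin x
    · exact ⟨x, hx, hxmin.eq_of_le hzx ▸ hz, le_rfl⟩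
    · rcases hdown W hW x ⟨z, hz, hzx⟩ hxmin with ⟨g, hg, hgc, hgW, hleast⟩ | ⟨w, hw, hw', hwx⟩
      · have hgx : g ≤ x := hleast x ⟨z, hz, hzx⟩ hxmin
        by_cases hgW' : g ∈ W
        · exact ⟨g, by simp [hg], hgW', hgx⟩
        · obtain ⟨-, htg, -, -, htW⟩ := ht g hg
          refine ⟨t g, ?_, htW hgc W hW hgW hleast hgW', htg.trans hgx⟩
          simp only [Finset.coe_insert, Finset.coe_union, Finset.coe_image]
          exact Or.inr (Or.inr ⟨g, hg, rfl⟩)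
      · refine ⟨w, ?_, hw, hwx⟩
        simp only [Finset.coe_insert, Finset.coe_union, Finset.coe_image]
        rcases hw' with rfl | rfl | rfl
        · exact Or.inr (Or.inl hcS)
        · exact Or.inr (Or.inr ⟨c, hcS, htc⟩)
        · exact Or.inl rfl
  -- If `s = m`, it is already the tooth of `c` and a comb results. Otherwise `s` is a handle; it is
  -- no other tooth because those are not below `c`.
  · by_cases hsm : s = m
    · left
      rw [Finset.insert_eq_of_mem
        (Finset.mem_union_right _ (Finset.mem_image.2 ⟨c, hcS, htc.trans hsm.symm⟩))]
      exact nonempty_orderIso_comb ⟨c, hcS⟩ hchain hS (fun y hy => (ht y hy).1)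
        (fun y hy => (ht y hy).2.1) fun y hy => (ht y hy).2.2.1
    · right
      refine nonempty_orderIso_hcomb hchain hS (fun y hy => (ht y hy).1)
        (fun y hy => (ht y hy).2.1) (fun y hy => (ht y hy).2.2.1) hs
        (fun y hy => hsc.trans (hc y hy)) fun y hy hty => ?_
      by_cases hyc : y = c
      · exact hsm (hty.symm.trans (hyc ▸ htc))
      · exact (ht y hy).2.2.1 c hcS (lt_of_le_of_ne (hc y hy) (Ne.symm hyc)) (hty ▸ hsc)

theorem exists_selective_comb (hX : IsCoTree X) (hLFC : Validates X LFC) {r : X}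
    (hr : ∀ x, x ≤ r) (hrmin : ¬ IsMin r) {F : Set (Set X)} (hfin : F.Finite)
    (hF : ∀ W ∈ F, IsClopen W) :
    ∃ Y : Finset X, r ∈ Y ∧ IsSelective (Y : Set X) F ∧
      ((∃ k : ℕ, 0 < k ∧ Nonempty ({x : X // x ∈ Y} ≃o Comb k)) ∨
        ∃ k : ℕ, Nonempty ({x : X // x ∈ Y} ≃o HComb k)) := by
  classical
  have tot := @le_total_of_not_isMin X _ _ _ hX hLFC
  have hgreatest (W : Set X) : ∃ g, ¬ IsMin g ∧
      (W ∈ F → ∀ z ∈ W, ¬ IsMin z → g ∈ W ∧ z ≤ g) := by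
    by_cases h : W ∈ F ∧ ∃ z ∈ W, ¬ IsMin z
    · obtain ⟨hW, z, hz, hzmin⟩ := h
      obtain ⟨g, hg, hgmin, hgle⟩ := exists_greatest_not_isMin hX hLFC (hF W hW) hz hzmin
      exact ⟨g, hgmin, fun _ z hz hzmin => ⟨hg, hgle z hz hzmin⟩⟩
    -- When there is nothing to witness, the co-root serves as a harmless default.
    · exact ⟨r, hrmin, fun hW z hz hzmin => absurd ⟨hW, z, hz, hzmin⟩ h⟩
  have hleast (W : Set X) : ∃ g, ¬ IsMin g ∧ (W ∈ F → ∀ z ∈ up W, ¬ IsMin z →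
      (g ∈ up W ∧ ∀ y ∈ up W, ¬ IsMin y → g ≤ y) ∨
      (¬ ∃ x : X, ¬ IsMin x ∧ ∀ y, ¬ IsMin y → x ≤ y) ∧
        ∃ i ∈ W, IsMin i ∧ ∀ y, ¬ IsMin y → i ≤ y) := by
    by_cases h : W ∈ F ∧ ∃ z ∈ up W, ¬ IsMin z
    · obtain ⟨hW, z, hz, hzmin⟩ := h
      rcases exists_least_not_isMin hX hLFC (hF W hW) hz hzmin with ⟨g, hg, hgmin, hgle⟩ | h
      · exact ⟨g, hgmin, fun _ z hz hzmin => Or.inl ⟨hg, hgle⟩⟩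
      · exact ⟨r, hrmin, fun _ _ _ _ => Or.inr h⟩
    · exact ⟨r, hrmin, fun hW z hz hzmin => absurd ⟨hW, z, hz, hzmin⟩ h⟩
  choose g hgmin hg using hgreatest
  choose h hhmin hh using hleast
  let G : Finset X := insert r (hfin.toFinset.image g ∪ hfin.toFinset.image h)
  have hrG : r ∈ G := Finset.mem_insert_self _ _
  have hgG (W) (hW : W ∈ F) : g W ∈ G := Finset.mem_insert_of_mem
    (Finset.mem_union_left _ (Finset.mem_image_of_mem g (hfin.mem_toFinset.2 hW)))
  have hhG (W) (hW : W ∈ F) : h W ∈ G := Finset.mem_insert_of_mem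
    (Finset.mem_union_right _ (Finset.mem_image_of_mem h (hfin.mem_toFinset.2 hW)))
  have hGmin (x) (hx : x ∈ G) : ¬ IsMin x := by
    rcases Finset.mem_insert.1 hx with rfl | hx
    · exact hrmin
    rcases Finset.mem_union.1 hx with hx | hx
    · obtain ⟨W, -, rfl⟩ := Finset.mem_image.1 hx
      exact hgmin W
    · obtain ⟨W, -, rfl⟩ := Finset.mem_image.1 hx
      exact hhmin W
  suffices H : ∃ c m s, ¬ IsMin c ∧ (∀ y ∈ G, c ≤ y) ∧ IsMin m ∧ m ≤ c ∧ IsMin s ∧ s ≤ c ∧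
      ∀ W ∈ F, ∀ z ∈ up W, ¬ IsMin z →
        (∃ g ∈ G, g ≠ c ∧ g ∈ up W ∧ ∀ y ∈ up W, ¬ IsMin y → g ≤ y) ∨
          ∃ w ∈ W, (w = c ∨ w = m ∨ w = s) ∧ w ≤ z by
    obtain ⟨c, m, s, hc, hcG, hm, hmc, hs, hsc, hdown⟩ := H
    obtain ⟨Y, hGY, hY, hiso⟩ := exists_selective_comb_of_chain hX hLFC hF (S := insert c G)
      (c := c) (m := m) (s := s) (Finset.forall_mem_insert _ _ _ |>.2 ⟨hc, hGmin⟩)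
      (fun W hW z hz hzmin => ⟨g W, Finset.mem_insert_of_mem (hgG W hW), hg W hW z hz hzmin⟩)
      (Finset.mem_insert_self _ _) (by simpa using hcG) hm hmc hs hsc
      (fun W hW z hz hzmin => (hdown W hW z hz hzmin).imp
        (fun ⟨g, hgG, hg⟩ => ⟨g, Finset.mem_insert_of_mem hgG, hg⟩) id)
    exact ⟨Y, hGY r (Finset.mem_insert_of_mem hrG), hY, hiso⟩
  by_cases hex : ∃ x : X, ¬ IsMin x ∧ ∀ y, ¬ IsMin y → x ≤ y
  · obtain ⟨c, hc, hcle⟩ := hex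
    obtain ⟨m, hm, hmc⟩ := exists_isMin_le c
    -- At most two minimal points lie below `c`; they become `m` and `s`, with `s = m` if there is
    -- only one.
    obtain ⟨s, hs, hsc, hms⟩ : ∃ s, IsMin s ∧ s ≤ c ∧ ∀ w, IsMin w → w ≤ c → w = m ∨ w = s := by
      by_cases h : ∃ s, IsMin s ∧ s ≤ c ∧ m ≠ s
      · obtain ⟨s, hs, hsc, hms⟩ := h
        exact ⟨s, hs, hsc, fun w hw hwc =>
          isMin_below_least hX hLFC hc hcle hmc hsc hwc hm hs hw hms⟩
      · push Not at h
        exact ⟨m, hm, hmc, fun w hw hwc => Or.inl (h w hw hwc).symm⟩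
    refine ⟨c, m, s, hc, fun y hy => hcle y (hGmin y hy), hm, hmc, hs, hsc, ?_⟩
    intro W hW z hz hzmin
    rcases hh W hW z hz hzmin with ⟨hW', hWle⟩ | ⟨hno, -⟩
    · by_cases hhc : h W = c
      · obtain ⟨w, hw, hwc⟩ := hhc ▸ hW'
        refine Or.inr ⟨w, hw, ?_, hwc.trans (hcle z hzmin)⟩
        by_cases hwmin : IsMin w
        · exact Or.inr (hms w hwmin hwc)
        · exact Or.inl (le_antisymm hwc (hcle w hwmin))
      · exact Or.inl ⟨h W, hhG W hW, hhc, hW', hWle⟩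
    · exact absurd ⟨c, hc, hcle⟩ hno
  · obtain ⟨i, hi, hile⟩ : ∃ i : X, IsMin i ∧ ∀ y, ¬ IsMin y → i ≤ y := by
      rcases exists_least_not_isMin hX hLFC isClopen_univ (z := r) ⟨r, trivial, le_rfl⟩ hrmin with
        ⟨x, -, hx, hxle⟩ | ⟨-, i, -, hi⟩
      · exact absurd ⟨x, hx, fun y hy => hxle y ⟨y, trivial, le_rfl⟩ hy⟩ hex
      · exact ⟨i, hi⟩
    obtain ⟨d, hd⟩ := G.exists_minimal ⟨r, hrG⟩
    have hdle (y) (hy : y ∈ G) : d ≤ y :=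
      (tot (hGmin d hd.prop) (hGmin y hy)).elim id fun h => hd.le_of_le hy h
    -- Without a least non-minimal point, `c` can be taken strictly below `G`. Its tooth `i` then
    -- witnesses every `W` whose non-minimal upset has no least element, and `c` is no extremal
    -- witness itself.
    obtain ⟨c, hc, hdc⟩ : ∃ c, ¬ IsMin c ∧ ¬ d ≤ c := by
      by_contra! hall
      exact hex ⟨d, hGmin d hd.prop, hall⟩
    have hcd : c ≤ d := (tot hc (hGmin d hd.prop)).resolve_right hdc
    refine ⟨c, i, i, hc, fun y hy => hcd.trans (hdle y hy), hi, hile c hc, hi, hile c hc, ?_⟩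
    intro W hW z hz hzmin
    rcases hh W hW z hz hzmin with ⟨hW', hWle⟩ | ⟨-, j, hj, hjmin, hjle⟩
    · exact Or.inl ⟨h W, hhG W hW, fun h' => hdc (h' ▸ hdle _ (hhG W hW)), hW', hWle⟩
    · refine Or.inr ⟨j, hj, Or.inr (Or.inl ?_), hjle z hzmin⟩
      exact isMin_lowerBound_unique hX hLFC hrmin hex hi hjle hile

end Selection

end BiInt

end

/-- The proof works for every infinite bi-Esakia co-tree validating `LFC`: that the dual algebra is
finitely generated is not used. -/
theorem mainTheorem5 {X : Type*} [PartialOrder X] [TopologicalSpace X] [BiInt.BiEsakiaSpace X]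
    (hcotree : BiInt.IsCoTree X) (hinf : Infinite X) (hLFC : BiInt.Validates X BiInt.LFC)
    (n : ℕ) (hn : 0 < n) (hgen : BiInt.IsNGenerated (ClopenUpperSet X) n)
    (φ : BiInt.Fm) (hφ : BiInt.Refutes X φ) :
    ∃ Y : Finset X,
      BiInt.Refutes (BiInt.WithDiscrete {x : X // x ∈ Y}) φ ∧
        ((∃ k : ℕ, 0 < k ∧ Nonempty ({x : X // x ∈ Y} ≃o BiInt.Comb k)) ∨
          ∃ k : ℕ, Nonempty ({x : X // x ∈ Y} ≃o BiInt.HComb k)) := by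
  obtain ⟨r, hr⟩ := hcotree.exists_coroot
  -- Infinitude supplies a second point, so the co-root is non-minimal and can belong to the spine.
  have hrmin : ¬ IsMin r := by
    obtain ⟨x, hx⟩ := exists_ne r
    exact fun h => hx (h.eq_of_le (hr x))
  obtain ⟨v, hv⟩ := hφ
  obtain ⟨Y, hrY, hY, hiso⟩ := BiInt.exists_selective_comb hcotree hLFC hr hrmin
    (F := insert {x | x ∉ φ.eval v} (BiInt.witnessSets v φ))
    ((BiInt.finite_witnessSets v φ).insert _)
    (by
      rintro W (rfl | hW)
      · exact (φ.eval v).isClopen.compl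
      · exact BiInt.isClopen_of_mem_witnessSets v φ hW)
  exact ⟨Y, BiInt.refutes_of_isSelective hY hr hrY hv, hiso⟩
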